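/- **Definitions.** A *global action* $\mathsf A$ consists of a set $|\mathsf A|$, an index set $\Phi$ with a reflexive relation $\le$, for each $\alpha\in\Phi$ a group $G_\alpha$ acting on a subset $X_\alpha\subseteq|\mathsf A|$, and for $\alpha\le\beta$ a homomorphism $G_\alpha\to G_\beta$ such that $G_\alpha$ leaves $X_\alpha\cap X_\beta$ invariant and $\sigma\in G_\alpha$ and its image in $G_\beta$ act equally on $X_\alpha\cap X_\beta$. A *local frame* is a finite sequence $x_0,\dots,x_p$ contained in one $G_\alpha$-orbit in $X_\alpha$ for some $\alpha$. A *morphism* is a map of underlying sets preserving local frames; a *regular morphism* consists of a map of underlying sets, a relation-preserving map of index sets, and compatible homomorphisms of local groups for which the map is equivariant. A morphism $q:\mathsf B\to\mathsf A$ is a *covering* if for every local frame $x_0,\dots,x_p$ of $\mathsf A$ and every $y_0\in q^{-1}(x_0)$ there is a unique local frame $y_0,\dots,y_p$ of $\mathsf B$ with $q(y_i)=x_i$ for all $i$. The *line* $\mathsf L$ has underlying set $\mathbb Z$, coordinates $n\in\mathbb Z$ with the group of order two permuting $\{n,n+1\}$, and a bottom coordinate with the trivial group acting on $\mathbb Z$.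 A *path* from $a$ to $b$ is a morphism $\mathsf L\to\mathsf A$ that is constantly $a$ far to the left and constantly $b$ far to the right; a *homotopy* between two such paths is a morphism $\mathsf L\times\mathsf L\to\mathsf A$, where the product has coordinates $\Phi_{\mathsf L}\times\Phi_{\mathsf L}$ and product actions, which outside a finite square equals the first path below, the second path above, $a$ on the left and $b$ on the right. $\pi_1(\mathsf A,a)$ is the group of homotopy classes of loops at $a$ under concatenation. $\mathsf A$ is *connected* if it is non-empty and any two points are joined by a path, and *simply connected* if moreover all its fundamental groups are trivial. The *universal covering* $\tilde{\mathsf A}$ of $(\mathsf A,a)$ has as points the homotopy classes of paths starting at $a$, the coordinates and local groups of $\mathsf A$, local sets the classes of paths ending in $X_\alpha$, and $\sigma\in G_\alpha$ acts by appending to a path ending at $x$ one step from $x$ to $\sigma x$; it maps to $\mathsf A$ by the end point. Let $R$ be an associative ring with identity and $n$ a positive integer. Let $\Delta=\{(i,j): i\ne j\}$ be the set of off-diagonal positions of an $n\times n$ array, and let $\Phi$ be the set, ordered by inclusion, of closed subsets $\alpha\subseteq\Delta$, i.e. those with $(i,k)\in\alpha$ whenever $(i,j),(j,k)\in\alpha$.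 Let $\varepsilon_{ij}(r)$ be the elementary matrices. $\mathsf{GL}_n(R)$ is the global action on the set $\mathrm{GL}_n(R)$ with coordinate system $\Phi$, in which $\mathrm{GL}_n(R)_\alpha=\langle \varepsilon_{ij}(r): (i,j)\in\alpha, r\in R\rangle$ acts on the whole set by left multiplication. The Steinberg group $\mathrm{St}_n(R)$ is generated by $x_{ij}(r)$ ($(i,j)\in\Delta$, $r\in R$) with relations $x_{ij}(a)x_{ij}(b)=x_{ij}(a+b)$; $[x_{ij}(a),x_{kl}(b)]=1$ if $i\neq l$, $j\ne k$; $[x_{ij}(a),x_{jl}(b)]=x_{il}(ab)$ if $i\ne l$. For $\alpha\in\Phi$, $\mathrm{St}_n(R)_\alpha$ is the group with generators $x_{ij}(r)$, $(i,j)\in\alpha$, and those of these relations that involve only positions in $\alpha$. The Steinberg global action $\mathsf{St}_n(R)$ has underlying set $\mathrm{St}_n(R)$, coordinate system $\Phi$, and local groups $\mathrm{St}_n(R)_\alpha$ acting on the whole set by left multiplication through the natural map $\mathrm{St}_n(R)_\alpha\to \mathrm{St}_n(R)$. Let $\varphi:\mathrm{St}_n(R)\to\mathrm{GL}_n(R)$,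 $x_{ij}(r)\mapsto\varepsilon_{ij}(r)$, be the evaluation homomorphism, let $E_n(R)$ be the subgroup generated by all $\varepsilon_{ij}(r)$, and let $K_2(n,R)=\mathrm{Ker}(\mathrm{St}_n(R)\to E_n(R))$. **Theorem.** $\mathsf{St}_n(R)$ is simply connected, and evaluation $\varphi:\mathsf{St}_n(R)\to\mathsf{GL}_n(R)$ is a covering. Its image is $E_n(R)$, which is the connected component of $1$ in $\mathsf{GL}_n(R)$, and $\varphi$ is a surjective covering of the global action given by the left multiplications of the groups $\mathrm{GL}_n(R)_\alpha$ on $E_n(R)$. Moreover $\mathsf{St}_n(R)$ is the simply connected universal covering of $\mathsf{GL}_n(R)$ at the base point $1$: there is a regular isomorphism from $\mathsf{St}_n(R)$ to the universal covering $\widetilde{\mathsf{GL}_n(R)}$ of $(\mathsf{GL}_n(R),1)$, the identity on coordinates, which preserves base points and carries the end point projection to $\varphi$; and for every covering $q:\mathsf B\to\mathsf{GL}_n(R)$ and $b\in q^{-1}(1)$ there is a unique morphism $f:\mathsf{St}_n(R)\to\mathsf B$ with $f(1)=b$ and $qf=\varphi$. **Corollary.** $K_2(n,R)\cong\pi_1(\mathsf{GL}_n(R),1)$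 as groups. -/

import Mathlib

universe u u₁ u₂ u₃ v w

/-- A global action: a set `carrier`, a coordinate system `Coord` with a reflexive relation `le`
(not assumed transitive), group actions of the local groups `Grp α` on the local sets
`dom α ⊆ carrier` (not assumed to cover), and structure homomorphisms `Grp α →* Grp β` for
`le α β`, compatible with the actions on `dom α ∩ dom β`. -/
structure GlobalAction where
  carrier : Type u
  Coord : Type v
  le : Coord → Coord → Prop
  le_refl : ∀ α, le α α
  dom : Coord → Set carrier
  Grp : Coord → Type w
  [group : ∀ α, Group (Grp α)]
  [action : ∀ α, MulAction (Grp α) (dom α)]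
  map : ∀ {α β : Coord}, le α β → (Grp α →* Grp β)
  smul_mem : ∀ {α β : Coord}, le α β → ∀ (σ : Grp α) (x : dom α),
    (x : carrier) ∈ dom β → ((σ • x : dom α) : carrier) ∈ dom β
  smul_eq : ∀ {α β : Coord} (h : le α β) (σ : Grp α) (x : carrier) (hα : x ∈ dom α)
    (hβ : x ∈ dom β),
    ((σ • (⟨x, hα⟩ : dom α) : dom α) : carrier) = ((map h σ • (⟨x, hβ⟩ : dom β) : dom β) : carrier)

namespace GlobalAction

attribute [instance] GlobalAction.group GlobalAction.action

instance : CoeSort GlobalAction.{u, v, w} (Type u) := ⟨GlobalAction.carrier⟩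

/-! ### Local frames, morphisms, coverings -/

/-- The finite sequence `x 0, …, x p` is an `α`-frame: all its members lie in the local orbit of
`x 0 ∈ dom α` under the local group `Grp α`. -/
def IsFrameIn (A : GlobalAction.{u, v, w}) (α : A.Coord) {p : ℕ} (x : Fin (p + 1) → A) : Prop :=
  ∃ h : x 0 ∈ A.dom α, ∀ i, ∃ g : A.Grp α, ((g • (⟨x 0, h⟩ : A.dom α) : A.dom α) : A) = x i

/-- A local frame is an `α`-frame for some coordinate `α`. -/
def IsLocalFrame (A : GlobalAction.{u, v, w}) {p : ℕ} (x : Fin (p + 1) → A) : Prop :=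
  ∃ α, A.IsFrameIn α x

/-- A (weak) morphism of global actions is a map of underlying sets preserving local frames. -/
def IsMorphism (A : GlobalAction.{u, v, w}) (B : GlobalAction.{u₁, u₂, u₃}) (f : A → B) : Prop :=
  ∀ (p : ℕ) (x : Fin (p + 1) → A), A.IsLocalFrame x → B.IsLocalFrame (fun i => f (x i))

/-- A covering map is a morphism with the unique local frame lifting property. -/
def IsCovering (B : GlobalAction.{u₁, u₂, u₃}) (A : GlobalAction.{u, v, w}) (q : B → A) : Prop :=
  IsMorphism B A q ∧
  ∀ (p : ℕ) (x : Fin (p + 1) → A), A.IsLocalFrame x → ∀ y₀ : B, q y₀ = x 0 →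
    ∃! y : Fin (p + 1) → B, B.IsLocalFrame y ∧ y 0 = y₀ ∧ ∀ i, q (y i) = x i

/-- A regular morphism of global actions. -/
structure RegularMorphism (A : GlobalAction.{u, v, w}) (B : GlobalAction.{u₁, u₂, u₃}) where
  toFun : A → B
  coordMap : A.Coord → B.Coord
  coordMap_le : ∀ {α β}, A.le α β → B.le (coordMap α) (coordMap β)
  grpMap : ∀ α, A.Grp α →* B.Grp (coordMap α)
  grpMap_naturality : ∀ {α β} (h : A.le α β) (σ : A.Grp α),
    grpMap β (A.map h σ) = B.map (coordMap_le h) (grpMap α σ)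
  mapsTo : ∀ α (x : A), x ∈ A.dom α → toFun x ∈ B.dom (coordMap α)
  equivariant : ∀ α (σ : A.Grp α) (x : A) (hx : x ∈ A.dom α),
    toFun ((σ • (⟨x, hx⟩ : A.dom α) : A.dom α) : A)
      = ((grpMap α σ • (⟨toFun x, mapsTo α x hx⟩ : B.dom (coordMap α)) :
          B.dom (coordMap α)) : B)

/-- A regular morphism is an isomorphism (has an inverse regular morphism) iff it is bijective on
points, on coordinates and on each local group, and reflects the relation on coordinates and
membership in the local sets. -/
structure RegularMorphism.IsIso {A : GlobalAction.{u, v, w}} {B : GlobalAction.{u₁, u₂, u₃}}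
    (η : RegularMorphism A B) : Prop where
  bijective_toFun : Function.Bijective η.toFun
  bijective_coordMap : Function.Bijective η.coordMap
  le_of_coordMap_le : ∀ α β, B.le (η.coordMap α) (η.coordMap β) → A.le α β
  bijective_grpMap : ∀ α, Function.Bijective (η.grpMap α)
  mem_dom_of_toFun_mem : ∀ α (x : A), η.toFun x ∈ B.dom (η.coordMap α) → x ∈ A.dom α

/-! ### Subsets of local orbits -/

/-- The set `s` is contained in a single local orbit. -/
def IsLocal (A : GlobalAction.{u, v, w}) (s : Set A) : Prop :=
  ∃ (α : A.Coord) (z : A.dom α), ∀ y ∈ s, ∃ g : A.Grp α, ((g • z : A.dom α) : A) = y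

theorem IsLocal.mono {A : GlobalAction.{u, v, w}} {s t : Set A} (ht : A.IsLocal t) (h : s ⊆ t) :
    A.IsLocal s := by
  obtain ⟨α, z, hz⟩ := ht
  exact ⟨α, z, fun y hy => hz y (h hy)⟩

theorem isLocalFrame_iff (A : GlobalAction.{u, v, w}) {p : ℕ} (x : Fin (p + 1) → A) :
    A.IsLocalFrame x ↔ A.IsLocal (Set.range x) := by
  constructor
  · rintro ⟨α, h, hx⟩
    refine ⟨α, ⟨x 0, h⟩, ?_⟩
    rintro _ ⟨i, rfl⟩
    exact hx i
  · rintro ⟨α, z, hz⟩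
    obtain ⟨g₀, h₀⟩ := hz (x 0) ⟨0, rfl⟩
    have hmem : x 0 ∈ A.dom α := h₀ ▸ (g₀ • z).2
    have e : (⟨x 0, hmem⟩ : A.dom α) = g₀ • z := Subtype.ext h₀.symm
    refine ⟨α, hmem, fun i => ?_⟩
    obtain ⟨g, hg⟩ := hz (x i) ⟨i, rfl⟩
    refine ⟨g * g₀⁻¹, ?_⟩
    rw [e, smul_smul, inv_mul_cancel_right, hg]

/-! ### Products and the line -/

/-- The product of two global actions. -/
abbrev prod (A : GlobalAction.{u, v, w}) (B : GlobalAction.{u₁, u₂, u₃}) :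
    GlobalAction.{max u u₁, max v u₂, max w u₃} where
  carrier := A × B
  Coord := A.Coord × B.Coord
  le c d := A.le c.1 d.1 ∧ B.le c.2 d.2
  le_refl c := ⟨A.le_refl _, B.le_refl _⟩
  dom c := {x | x.1 ∈ A.dom c.1 ∧ x.2 ∈ B.dom c.2}
  Grp c := A.Grp c.1 × B.Grp c.2
  action c :=
    { smul := fun g x => ⟨(((g.1 • (⟨x.1.1, x.2.1⟩ : A.dom c.1) : A.dom c.1) : A),
          ((g.2 • (⟨x.1.2, x.2.2⟩ : B.dom c.2) : B.dom c.2) : B)),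
          (g.1 • (⟨x.1.1, x.2.1⟩ : A.dom c.1)).2, (g.2 • (⟨x.1.2, x.2.2⟩ : B.dom c.2)).2⟩
      one_smul := fun x => Subtype.ext (Prod.ext
        (congrArg Subtype.val (one_smul (A.Grp c.1) (⟨x.1.1, x.2.1⟩ : A.dom c.1)))
        (congrArg Subtype.val (one_smul (B.Grp c.2) (⟨x.1.2, x.2.2⟩ : B.dom c.2))))
      mul_smul := fun g h x => Subtype.ext (Prod.ext
        (congrArg Subtype.val (mul_smul g.1 h.1 (⟨x.1.1, x.2.1⟩ : A.dom c.1)))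
        (congrArg Subtype.val (mul_smul g.2 h.2 (⟨x.1.2, x.2.2⟩ : B.dom c.2)))) }
  map h := (A.map h.1).prodMap (B.map h.2)
  smul_mem h σ x hx := ⟨A.smul_mem h.1 σ.1 ⟨x.1.1, x.2.1⟩ hx.1, B.smul_mem h.2 σ.2 ⟨x.1.2, x.2.2⟩ hx.2⟩
  smul_eq h σ x hα hβ := Prod.ext (A.smul_eq h.1 σ.1 x.1 hα.1 hβ.1)
    (B.smul_eq h.2 σ.2 x.2 hα.2 hβ.2)

/-- The local sets of the line: all of `ℤ` for the bottom coordinate `none`, and `{n, n + 1}` for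
the coordinate `some n`. -/
def lineDom : Option ℤ → Set ℤ
  | none => Set.univ
  | some n => {n, n + 1}

/-- The local groups of the line, as permutation groups of the local sets: trivial for the bottom
coordinate, and the group of order two of all permutations of `{n, n + 1}` for `some n`. -/
def lineGrp : (c : Option ℤ) → Subgroup (Equiv.Perm (lineDom c))
  | none => ⊥
  | some _ => ⊤

/-- The relation on the coordinates of the line: `none` is below everything, and otherwise the
relation is equality. -/
def lineLe (c d : Option ℤ) : Prop := c = none ∨ c = d

open Classical in
/-- The structure homomorphisms of the line: trivial out of the bottom coordinate, and otherwise
the identity. -/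
noncomputable def lineMap {c d : Option ℤ} (h : lineLe c d) : lineGrp c →* lineGrp d :=
  if hc : c = none then 1 else (h.resolve_left hc) ▸ MonoidHom.id (lineGrp c)

theorem lineMap_smul {c d : Option ℤ} (h : lineLe c d) (σ : lineGrp c) (x : ℤ)
    (hc : x ∈ lineDom c) (hd : x ∈ lineDom d) :
    ((σ • (⟨x, hc⟩ : lineDom c) : lineDom c) : ℤ)
      = ((lineMap h σ • (⟨x, hd⟩ : lineDom d) : lineDom d) : ℤ) := by
  by_cases h0 : c = none
  · subst h0
    have : σ = 1 := Subtype.ext (Subgroup.mem_bot.1 σ.2)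
    subst this
    simp [lineMap]
  · obtain rfl : c = d := h.resolve_left h0
    simp [lineMap, h0]

/-- The line: the global action with underlying set `ℤ` whose non-trivial local frames are the
adjacent pairs `{n, n + 1}`. -/
noncomputable abbrev line : GlobalAction.{0, 0, 0} where
  carrier := ℤ
  Coord := Option ℤ
  le := lineLe
  le_refl _ := Or.inr rfl
  dom := lineDom
  Grp c := lineGrp c
  map := lineMap
  smul_mem h σ x hx := by
    have := lineMap_smul h σ x x.2 hx
    rw [Subtype.coe_eta] at this
    rw [this]
    exact Subtype.coe_prop _
  smul_eq h σ x hα hβ := lineMap_smul h σ x hα hβ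

theorem line_isLocal_iff (s : Set line) : line.IsLocal s ↔ ∃ n : ℤ, ∀ x ∈ s, x = n ∨ x = n + 1 := by
  change (∃ (c : Option ℤ) (z : lineDom c), ∀ y ∈ s, ∃ g : lineGrp c,
    ((g • z : lineDom c) : ℤ) = y) ↔ _
  constructor
  · rintro ⟨c, z, hz⟩
    rcases c with _ | n
    · refine ⟨z.1, fun x hx => Or.inl ?_⟩
      obtain ⟨g, rfl⟩ := hz x hx
      have : g = 1 := Subtype.ext (Subgroup.mem_bot.1 g.2)
      subst this
      rw [one_smul]
    · refine ⟨n, fun x hx => ?_⟩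
      obtain ⟨g, rfl⟩ := hz x hx
      exact (g • z).2
  · rintro ⟨n, hn⟩
    refine ⟨some n, ⟨n, Or.inl rfl⟩, fun x hx => ?_⟩
    refine ⟨⟨Equiv.swap ⟨n, Or.inl rfl⟩ ⟨x, hn x hx⟩, Subgroup.mem_top _⟩, ?_⟩
    exact congrArg Subtype.val (Equiv.swap_apply_left (⟨n, Or.inl rfl⟩ : lineDom (some n))
      ⟨x, hn x hx⟩)

theorem prod_isLocal_iff (A : GlobalAction.{u, v, w}) (B : GlobalAction.{u₁, u₂, u₃})
    (s : Set (A.prod B)) :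
    (A.prod B).IsLocal s ↔ A.IsLocal (Prod.fst '' s) ∧ B.IsLocal (Prod.snd '' s) := by
  constructor
  · rintro ⟨c, z, hz⟩
    constructor
    · refine ⟨c.1, ⟨z.1.1, z.2.1⟩, ?_⟩
      rintro _ ⟨x, hx, rfl⟩
      obtain ⟨g, rfl⟩ := hz x hx
      exact ⟨g.1, rfl⟩
    · refine ⟨c.2, ⟨z.1.2, z.2.2⟩, ?_⟩
      rintro _ ⟨x, hx, rfl⟩
      obtain ⟨g, rfl⟩ := hz x hx
      exact ⟨g.2, rfl⟩
  · rintro ⟨⟨α, a, ha⟩, ⟨β, b, hb⟩⟩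
    refine ⟨(α, β), ⟨(a.1, b.1), a.2, b.2⟩, fun x hx => ?_⟩
    obtain ⟨g, hg⟩ := ha x.1 ⟨x, hx, rfl⟩
    obtain ⟨k, hk⟩ := hb x.2 ⟨x, hx, rfl⟩
    exact ⟨(g, k), Prod.ext hg hk⟩

/-- A map out of the line is a morphism iff consecutive points lie in a common local orbit. -/
theorem isMorphism_line_iff (A : GlobalAction.{u, v, w}) (f : ℤ → A) :
    IsMorphism line A f ↔ ∀ n : ℤ, A.IsLocal {f n, f (n + 1)} := by
  constructor
  · intro h n
    have h1 : line.IsLocalFrame (p := 1) ![(n : line), (n + 1 : ℤ)] := by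
      rw [isLocalFrame_iff, line_isLocal_iff]
      refine ⟨n, ?_⟩
      rintro x ⟨i, rfl⟩
      fin_cases i
      · exact Or.inl rfl
      · exact Or.inr rfl
    have h2 := h 1 _ h1
    rw [isLocalFrame_iff] at h2
    refine h2.mono ?_
    rintro y (rfl | rfl)
    · exact ⟨0, rfl⟩
    · exact ⟨1, rfl⟩
  · intro h p x hx
    rw [isLocalFrame_iff, line_isLocal_iff] at hx
    obtain ⟨n, hn⟩ := hx
    rw [isLocalFrame_iff]
    refine (h n).mono ?_
    rintro _ ⟨i, rfl⟩
    rcases hn (x i) ⟨i, rfl⟩ with e | e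
    · exact Or.inl (congrArg f e)
    · exact Or.inr (congrArg f e)

/-- A map out of `line × line` is a morphism iff it maps every unit square into a local orbit. -/
theorem isMorphism_line_prod_line_iff (A : GlobalAction.{u, v, w}) (h : ℤ × ℤ → A) :
    IsMorphism (line.prod line) A h ↔
      ∀ m n : ℤ, A.IsLocal {h (m, n), h (m + 1, n), h (m, n + 1), h (m + 1, n + 1)} := by
  constructor
  · intro hh m n
    have h1 : (line.prod line).IsLocalFrame (p := 3)
        ![((m, n) : ℤ × ℤ), ((m + 1, n) : ℤ × ℤ), ((m, n + 1) : ℤ × ℤ),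
          ((m + 1, n + 1) : ℤ × ℤ)] := by
      rw [isLocalFrame_iff, prod_isLocal_iff, line_isLocal_iff, line_isLocal_iff]
      refine ⟨⟨m, ?_⟩, ⟨n, ?_⟩⟩ <;>
      · rintro x ⟨_, ⟨i, rfl⟩, rfl⟩
        fin_cases i <;> first | exact Or.inl rfl | exact Or.inr rfl
    have h2 := hh 3 _ h1
    rw [isLocalFrame_iff] at h2
    refine h2.mono ?_
    rintro y (rfl | rfl | rfl | rfl)
    · exact ⟨0, rfl⟩
    · exact ⟨1, rfl⟩
    · exact ⟨2, rfl⟩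
    · exact ⟨3, rfl⟩
  · intro hh p x hx
    rw [isLocalFrame_iff, prod_isLocal_iff, line_isLocal_iff, line_isLocal_iff] at hx
    obtain ⟨⟨m, hm⟩, ⟨n, hn⟩⟩ := hx
    rw [isLocalFrame_iff]
    refine (hh m n).mono ?_
    rintro _ ⟨i, rfl⟩
    have e : ∀ a b : ℤ, (x i).1 = a → (x i).2 = b → h (x i) = h (a, b) := by
      rintro a b rfl rfl
      rfl
    rcases hm _ ⟨_, ⟨i, rfl⟩, rfl⟩ with e1 | e1 <;> rcases hn _ ⟨_, ⟨i, rfl⟩, rfl⟩ with e2 | e2 <;>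
    · refine Set.mem_of_eq_of_mem (e _ _ e1 e2) ?_
      first
      | exact Or.inl rfl
      | exact Or.inr (Or.inl rfl)
      | exact Or.inr (Or.inr (Or.inl rfl))
      | exact Or.inr (Or.inr (Or.inr rfl))

/-! ### Paths and homotopies -/

/-- A path from `a` to `b`: a morphism from the line which stabilises to `a` on the left and to
`b` on the right. -/
structure Path (A : GlobalAction.{u, v, w}) (a b : A) where
  toFun : ℤ → A
  isMorphism : IsMorphism line A toFun
  stabilises : ∃ N M : ℤ, N ≤ M ∧ (∀ n ≤ N, toFun n = a) ∧ (∀ n ≥ M, toFun n = b)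

/-- A fixed end point homotopy `h : line × line → A` between two paths from `a` to `b`. -/
structure IsHomotopy {A : GlobalAction.{u, v, w}} {a b : A} (f₀ f₁ : A.Path a b)
    (h : ℤ × ℤ → A) : Prop where
  isMorphism : IsMorphism (line.prod line) A h
  stabilises : ∃ N M : ℤ, N ≤ M ∧
    (∀ n ≤ N, ∀ m, h (m, n) = f₀.toFun m) ∧ (∀ n ≥ M, ∀ m, h (m, n) = f₁.toFun m) ∧
    (∀ m ≤ N, ∀ n, h (m, n) = a) ∧ (∀ m ≥ M, ∀ n, h (m, n) = b)

/-- Two paths are homotopic if there is a fixed end point homotopy between them. -/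
def Homotopic {A : GlobalAction.{u, v, w}} {a b : A} (f₀ f₁ : A.Path a b) : Prop :=
  ∃ h, IsHomotopy f₀ f₁ h

section PathLemmas

variable {A : GlobalAction.{u, v, w}} {a b c d : A}

theorem Path.ext {f g : A.Path a b} (h : ∀ n, f.toFun n = g.toFun n) : f = g := by
  cases f
  cases g
  congr
  exact funext h

theorem Path.isLocal (f : A.Path a b) (n : ℤ) : A.IsLocal {f.toFun n, f.toFun (n + 1)} :=
  (isMorphism_line_iff A f.toFun).1 f.isMorphism n

theorem Path.exists_left (f : A.Path a b) : ∃ N, ∀ n ≤ N, f.toFun n = a := by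
  obtain ⟨N, M, -, h, -⟩ := f.stabilises
  exact ⟨N, h⟩

theorem Path.exists_right (f : A.Path a b) : ∃ N, ∀ n ≥ N, f.toFun n = b := by
  obtain ⟨N, M, -, -, h⟩ := f.stabilises
  exact ⟨M, h⟩

/-- Constructor for paths from the local condition and separate stabilisation bounds. -/
def Path.mk₂ (f : ℤ → A) (hf : ∀ n, A.IsLocal {f n, f (n + 1)}) (hl : ∃ N, ∀ n ≤ N, f n = a)
    (hr : ∃ N, ∀ n ≥ N, f n = b) : A.Path a b where
  toFun := f
  isMorphism := (isMorphism_line_iff A f).2 hf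
  stabilises := by
    obtain ⟨N, hN⟩ := hl
    obtain ⟨M, hM⟩ := hr
    exact ⟨min N M, max N M, by omega, fun n hn => hN n (by omega), fun n hn => hM n (by omega)⟩

theorem isHomotopy_mk₂ {f₀ f₁ : A.Path a b} {h : ℤ × ℤ → A}
    (hh : ∀ m n, A.IsLocal {h (m, n), h (m + 1, n), h (m, n + 1), h (m + 1, n + 1)})
    (h₁ : ∃ N, ∀ n ≤ N, ∀ m, h (m, n) = f₀.toFun m)
    (h₂ : ∃ N, ∀ n ≥ N, ∀ m, h (m, n) = f₁.toFun m)
    (h₃ : ∃ N, ∀ m ≤ N, ∀ n, h (m, n) = a)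
    (h₄ : ∃ N, ∀ m ≥ N, ∀ n, h (m, n) = b) : IsHomotopy f₀ f₁ h := by
  refine ⟨(isMorphism_line_prod_line_iff A h).2 hh, ?_⟩
  obtain ⟨N₁, h₁⟩ := h₁
  obtain ⟨N₂, h₂⟩ := h₂
  obtain ⟨N₃, h₃⟩ := h₃
  obtain ⟨N₄, h₄⟩ := h₄
  exact ⟨min (min N₁ N₂) (min N₃ N₄), max (max N₁ N₂) (max N₃ N₄), by omega,
    fun n hn => h₁ n (by omega), fun n hn => h₂ n (by omega),
    fun n hn => h₃ n (by omega), fun n hn => h₄ n (by omega)⟩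

theorem IsHomotopy.isLocal {f₀ f₁ : A.Path a b} {h : ℤ × ℤ → A} (H : IsHomotopy f₀ f₁ h) (m n : ℤ) :
    A.IsLocal {h (m, n), h (m + 1, n), h (m, n + 1), h (m + 1, n + 1)} :=
  (isMorphism_line_prod_line_iff A h).1 H.isMorphism m n

/-- The square condition for a map of the form `f ∘ ψ` with `f` a path. -/
theorem Path.isLocal_square (f : A.Path a b) {p q r s : ℤ} (k : ℤ) (hp : p = k ∨ p = k + 1)
    (hq : q = k ∨ q = k + 1) (hr : r = k ∨ r = k + 1) (hs : s = k ∨ s = k + 1) :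
    A.IsLocal {f.toFun p, f.toFun q, f.toFun r, f.toFun s} := by
  refine (f.isLocal k).mono ?_
  have key : ∀ t, t = k ∨ t = k + 1 → f.toFun t ∈ ({f.toFun k, f.toFun (k + 1)} : Set A) := by
    rintro t (rfl | rfl)
    · exact Or.inl rfl
    · exact Or.inr rfl
  rintro y (rfl | rfl | rfl | rfl)
  exacts [key _ hp, key _ hq, key _ hr, key _ hs]

theorem Homotopic.refl (f : A.Path a b) : Homotopic f f := by
  obtain ⟨N, hN⟩ := f.exists_left
  obtain ⟨M, hM⟩ := f.exists_right
  exact ⟨fun x => f.toFun x.1, isHomotopy_mk₂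
    (fun m n => f.isLocal_square m (Or.inl rfl) (Or.inr rfl) (Or.inl rfl) (Or.inr rfl))
    ⟨0, fun _ _ _ => rfl⟩ ⟨0, fun _ _ _ => rfl⟩ ⟨N, fun m hm _ => hN m hm⟩
    ⟨M, fun m hm _ => hM m hm⟩⟩

theorem Homotopic.symm {f g : A.Path a b} (H : Homotopic f g) : Homotopic g f := by
  obtain ⟨h, H⟩ := H
  obtain ⟨N, M, -, h₁, h₂, h₃, h₄⟩ := H.stabilises
  refine ⟨fun x => h (x.1, -x.2), isHomotopy_mk₂ (fun m n => ?_) ⟨-M, fun n hn m => ?_⟩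
    ⟨-N, fun n hn m => ?_⟩ ⟨N, fun m hm n => h₃ m hm _⟩ ⟨M, fun m hm n => h₄ m hm _⟩⟩
  · refine (H.isLocal m (-(n + 1))).mono ?_
    have e : -(n + 1) + 1 = -n := by ring
    rw [e]
    rintro y (rfl | rfl | rfl | rfl) <;> simp
  · exact h₂ _ (by omega) m
  · exact h₁ _ (by omega) m

theorem Homotopic.trans {f g k : A.Path a b} (H : Homotopic f g) (K : Homotopic g k) :
    Homotopic f k := by
  obtain ⟨h, H⟩ := H
  obtain ⟨h', K⟩ := K
  obtain ⟨N, M, -, h₁, h₂, h₃, h₄⟩ := H.stabilises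
  obtain ⟨N', M', -, h₁', h₂', h₃', h₄'⟩ := K.stabilises
  refine ⟨fun x => if x.2 ≤ M then h x else h' (x.1, x.2 - M + N'),
    isHomotopy_mk₂ (fun m n => ?_) ⟨min N M, fun n hn m => ?_⟩
    ⟨max (M + 1) (M' + M - N'), fun n hn m => ?_⟩
    ⟨min N N', fun m hm n => ?_⟩ ⟨max M M', fun m hm n => ?_⟩⟩
  · rcases lt_trichotomy n M with hn | rfl | hn
    · have e1 : n ≤ M := hn.le
      have e2 : n + 1 ≤ M := hn
      simpa only [e1, e2, if_true] using H.isLocal m n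
    · have e1 : n ≤ n := le_rfl
      have e2 : ¬ n + 1 ≤ n := by omega
      have e3 : n + 1 - n + N' = N' + 1 := by ring
      have := K.isLocal m N'
      rw [h₁' N' le_rfl, h₁' N' le_rfl] at this
      simpa only [e1, e2, e3, if_true, if_false, h₂ n le_rfl] using this
    · have e1 : ¬ n ≤ M := by omega
      have e2 : ¬ n + 1 ≤ M := by omega
      have e3 : n + 1 - M + N' = n - M + N' + 1 := by ring
      simpa only [e1, e2, e3, if_false] using K.isLocal m (n - M + N')
  · have e1 : n ≤ M := by omega
    simpa only [e1, if_true] using h₁ n (by omega) m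
  · have e1 : ¬ n ≤ M := by omega
    simpa only [e1, if_false] using h₂' _ (by omega) m
  · dsimp only
    split_ifs
    · exact h₃ m (by omega) n
    · exact h₃' m (by omega) _
  · dsimp only
    split_ifs
    · exact h₄ m (by omega) n
    · exact h₄' m (by omega) _

/-- Concatenation: go along `f` until the position `N`, where it has stabilised, then along `g`
from the position `M`, before which it is still constant. -/
def Path.concat (f : A.Path a b) (g : A.Path b c) (N M : ℤ) (hN : ∀ n ≥ N, f.toFun n = b)
    (hM : ∀ n ≤ M, g.toFun n = b) : A.Path a c :=
  Path.mk₂ (fun n => if n ≤ N then f.toFun n else g.toFun (n - N + M))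
    (by
      intro n
      rcases lt_trichotomy n N with hn | rfl | hn
      · have e1 : n ≤ N := hn.le
        have e2 : n + 1 ≤ N := hn
        simpa only [e1, e2, if_true] using f.isLocal n
      · have e1 : n ≤ n := le_rfl
        have e2 : ¬ n + 1 ≤ n := by omega
        have e3 : n + 1 - n + M = M + 1 := by ring
        have := g.isLocal M
        rw [hM M le_rfl] at this
        simpa only [e1, e2, e3, if_true, if_false, hN n le_rfl] using this
      · have e1 : ¬ n ≤ N := by omega
        have e2 : ¬ n + 1 ≤ N := by omega
        have e3 : n + 1 - N + M = n - N + M + 1 := by ring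
        simpa only [e1, e2, e3, if_false] using g.isLocal (n - N + M))
    (by
      obtain ⟨K, hK⟩ := f.exists_left
      refine ⟨min K N, fun n hn => ?_⟩
      have e1 : n ≤ N := by omega
      simpa only [e1, if_true] using hK n (by omega))
    (by
      obtain ⟨K, hK⟩ := g.exists_right
      refine ⟨max (N + 1) (K + N - M), fun n hn => ?_⟩
      have e1 : ¬ n ≤ N := by omega
      simpa only [e1, if_false] using hK _ (by omega))

theorem Path.concat_toFun (f : A.Path a b) (g : A.Path b c) (N M : ℤ) (hN) (hM) (n : ℤ) :
    (f.concat g N M hN hM).toFun n = if n ≤ N then f.toFun n else g.toFun (n - N + M) := rfl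

/-- Concatenation with fixed positions respects homotopy in the first variable. -/
theorem concat_homotopic_left {f f' : A.Path a b} (H : Homotopic f f') (g : A.Path b c) :
    ∃ K : ℤ, ∀ N ≥ K, ∀ M hN hN' hM,
      Homotopic (f.concat g N M hN hM) (f'.concat g N M hN' hM) := by
  obtain ⟨h, H⟩ := H
  obtain ⟨P, Q, -, h₁, h₂, h₃, h₄⟩ := H.stabilises
  refine ⟨Q, fun N hK M hN hN' hM => ?_⟩
  obtain ⟨S, hS⟩ := g.exists_right
  refine ⟨fun x => if x.1 ≤ N then h x else g.toFun (x.1 - N + M),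
    isHomotopy_mk₂ (fun m n => ?_) ⟨P, fun n hn m => ?_⟩ ⟨Q, fun n hn m => ?_⟩
    ⟨min N P, fun m hm n => ?_⟩ ⟨max (N + 1) (S + N - M), fun m hm n => ?_⟩⟩
  · rcases lt_trichotomy m N with hm | rfl | hm
    · have e1 : m ≤ N := hm.le
      have e2 : m + 1 ≤ N := hm
      simpa only [e1, e2, if_true] using H.isLocal m n
    · have e1 : m ≤ m := le_rfl
      have e2 : ¬ m + 1 ≤ m := by omega
      have e3 : m + 1 - m + M = M + 1 := by ring
      have := g.isLocal_square (p := M) (q := M + 1) (r := M) (s := M + 1) M (Or.inl rfl)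
        (Or.inr rfl) (Or.inl rfl) (Or.inr rfl)
      rw [hM M le_rfl] at this
      simpa only [e1, e2, e3, if_true, if_false, h₄ m hK] using this
    · have e1 : ¬ m ≤ N := by omega
      have e2 : ¬ m + 1 ≤ N := by omega
      simp only [e1, e2, if_false]
      exact g.isLocal_square (m - N + M) (Or.inl rfl) (Or.inr (by ring)) (Or.inl rfl)
        (Or.inr (by ring))
  · rw [Path.concat_toFun]
    dsimp only
    split_ifs
    · exact h₁ n hn m
    · rfl
  · rw [Path.concat_toFun]
    dsimp only
    split_ifs
    · exact h₂ n hn m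
    · rfl
  · have e1 : m ≤ N := by omega
    simpa only [e1, if_true] using h₃ m (by omega) n
  · have e1 : ¬ m ≤ N := by omega
    simpa only [e1, if_false] using hS _ (by omega)

/-- Concatenation with fixed positions respects homotopy in the second variable. -/
theorem concat_homotopic_right_of_eq (f : A.Path a b) {g g' : A.Path b c} {h : ℤ × ℤ → A}
    (H : IsHomotopy g g' h) (N M : ℤ) (hb : ∀ n, h (M, n) = b) (hN hM hM') :
    Homotopic (f.concat g N M hN hM) (f.concat g' N M hN hM') := by
  obtain ⟨P, Q, -, h₁, h₂, h₃, h₄⟩ := H.stabilises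
  obtain ⟨S, hS⟩ := f.exists_left
  refine ⟨fun x => if x.1 ≤ N then f.toFun x.1 else h (x.1 - N + M, x.2),
    isHomotopy_mk₂ (fun m n => ?_) ⟨P, fun n hn m => ?_⟩ ⟨Q, fun n hn m => ?_⟩
    ⟨min N S, fun m hm n => ?_⟩ ⟨max (N + 1) (Q + N - M), fun m hm n => ?_⟩⟩
  · rcases lt_trichotomy m N with hm | rfl | hm
    · have e1 : m ≤ N := hm.le
      have e2 : m + 1 ≤ N := hm
      simp only [e1, e2, if_true]
      exact f.isLocal_square m (Or.inl rfl) (Or.inr rfl) (Or.inl rfl) (Or.inr rfl)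
    · have e1 : m ≤ m := le_rfl
      have e2 : ¬ m + 1 ≤ m := by omega
      have e3 : m + 1 - m + M = M + 1 := by ring
      have := H.isLocal M n
      rw [hb n, hb (n + 1)] at this
      simpa only [e1, e2, e3, if_true, if_false, hN m le_rfl] using this
    · have e1 : ¬ m ≤ N := by omega
      have e2 : ¬ m + 1 ≤ N := by omega
      have e3 : m + 1 - N + M = m - N + M + 1 := by ring
      simpa only [e1, e2, e3, if_false] using H.isLocal (m - N + M) n
  · rw [Path.concat_toFun]
    dsimp only
    split_ifs
    · rfl
    · exact h₁ n hn _
  · rw [Path.concat_toFun]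
    dsimp only
    split_ifs
    · rfl
    · exact h₂ n hn _
  · have e1 : m ≤ N := by omega
    simpa only [e1, if_true] using hS m (by omega)
  · have e1 : ¬ m ≤ N := by omega
    simpa only [e1, if_false] using h₄ _ (by omega) n

theorem concat_homotopic_right (f : A.Path a b) {g g' : A.Path b c} (H : Homotopic g g') :
    ∃ K : ℤ, ∀ M ≤ K, ∀ N hN hM hM',
      Homotopic (f.concat g N M hN hM) (f.concat g' N M hN hM') := by
  obtain ⟨h, H⟩ := H
  obtain ⟨P, Q, -, h₁, h₂, h₃, h₄⟩ := H.stabilises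
  exact ⟨P, fun M hK N hN hM hM' =>
    concat_homotopic_right_of_eq f H N M (fun n => h₃ M hK n) hN hM hM'⟩

/-- The path `f` moved one place to the right. -/
def Path.shift (f : A.Path a b) : A.Path a b :=
  Path.mk₂ (fun n => f.toFun (n - 1))
    (fun n => by
      have := f.isLocal (n - 1)
      have e : n - 1 + 1 = n + 1 - 1 := by ring
      rwa [e] at this)
    (by
      obtain ⟨N, hN⟩ := f.exists_left
      exact ⟨N, fun n hn => hN _ (by omega)⟩)
    (by
      obtain ⟨N, hN⟩ := f.exists_right
      exact ⟨N + 1, fun n hn => hN _ (by omega)⟩)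

theorem Path.shift_toFun (f : A.Path a b) (n : ℤ) : f.shift.toFun n = f.toFun (n - 1) := rfl

/-- The ripple homotopy. -/
theorem shift_isHomotopy (f : A.Path a b) :
    IsHomotopy f.shift f (fun x => f.toFun (if x.1 ≤ x.2 then x.1 else x.1 - 1)) := by
  obtain ⟨N, hN⟩ := f.exists_left
  obtain ⟨M, hM⟩ := f.exists_right
  refine isHomotopy_mk₂ (fun m n => ?_) ⟨N, fun n hn m => ?_⟩ ⟨M, fun n hn m => ?_⟩
    ⟨N, fun m hm n => ?_⟩ ⟨M + 1, fun m hm n => ?_⟩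
  · refine f.isLocal_square (if m ≤ n then m else m - 1) ?_ ?_ ?_ ?_ <;>
    · dsimp only
      split_ifs <;> omega
  · rw [Path.shift_toFun]
    dsimp only
    split_ifs
    · rw [hN _ (by omega), hN _ (by omega)]
    · rfl
  · dsimp only
    split_ifs
    · rfl
    · rw [hM _ (by omega), hM _ (by omega)]
  · dsimp only
    split_ifs
    · exact hN _ (by omega)
    · exact hN _ (by omega)
  · dsimp only
    split_ifs
    · exact hM _ (by omega)
    · exact hM _ (by omega)

/-- The concatenation does not depend, up to homotopy, on the chosen positions. -/
theorem concat_succ_homotopic (f : A.Path a b) (g : A.Path b c) (N M : ℤ) (hN hM hN') :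
    Homotopic (f.concat g (N + 1) M hN' hM) (f.concat g N M hN hM) := by
  have hM' : ∀ n ≤ M, g.shift.toFun n = b := fun n hn => hM _ (by omega)
  have e : f.concat g (N + 1) M hN' hM = f.concat g.shift N M hN hM' := by
    refine Path.ext fun n => ?_
    rw [Path.concat_toFun, Path.concat_toFun, Path.shift_toFun]
    rcases lt_trichotomy n (N + 1) with hn | rfl | hn
    · rw [if_pos (by omega), if_pos (by omega)]
    · rw [if_pos (by omega), if_neg (by omega), hN _ (by omega), hM _ (by omega)]
    · rw [if_neg (by omega), if_neg (by omega)]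
      congr 1
      ring
  rw [e]
  refine concat_homotopic_right_of_eq f (shift_isHomotopy g) N M (fun n => ?_) hN hM' hM
  dsimp only
  split_ifs
  · exact hM _ le_rfl
  · exact hM _ (by omega)

theorem concat_left_homotopic (f : A.Path a b) (g : A.Path b c) {N N' : ℤ} (h : N ≤ N') (M : ℤ)
    (hN hM hN') : Homotopic (f.concat g N' M hN' hM) (f.concat g N M hN hM) := by
  induction N', h using Int.leInduction with
  | base => exact Homotopic.refl _
  | succ k hk ih =>
    have hk' : ∀ n ≥ k, f.toFun n = b := fun n hn => hN n (by omega)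
    exact (concat_succ_homotopic f g k M hk' hM hN').trans (ih hk')

theorem concat_right_eq (f : A.Path a b) (g : A.Path b c) {M M' : ℤ} (h : M' ≤ M) (N : ℤ)
    (hN hM hM' hN') :
    f.concat g N M' hN hM' = f.concat g (N + (M - M')) M hN' hM := by
  refine Path.ext fun n => ?_
  rw [Path.concat_toFun, Path.concat_toFun]
  by_cases h1 : n ≤ N
  · rw [if_pos h1, if_pos (by omega)]
  · rw [if_neg h1]
    by_cases h2 : n ≤ N + (M - M')
    · rw [if_pos h2, hN _ (by omega), hM _ (by omega)]
    · rw [if_neg h2]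
      congr 1
      ring

theorem concat_homotopic_concat (f : A.Path a b) (g : A.Path b c) (N M N' M' : ℤ)
    (hN hM hN' hM') : Homotopic (f.concat g N M hN hM) (f.concat g N' M' hN' hM') := by
  have key : ∀ (N M N' M' : ℤ) (hN hM hN' hM'), M' ≤ M →
      Homotopic (f.concat g N M hN hM) (f.concat g N' M' hN' hM') := by
    intro N M N' M' hN hM hN' hM' h
    have hN'' : ∀ n ≥ N' + (M - M'), f.toFun n = b := fun n hn => hN' n (by omega)
    rw [concat_right_eq f g h N' hN' hM hM' hN'']
    rcases le_total N (N' + (M - M')) with h1 | h1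
    · exact (concat_left_homotopic f g h1 M _ _ _).symm
    · exact concat_left_homotopic f g h1 M _ _ _
  rcases le_total M' M with h | h
  · exact key _ _ _ _ _ _ _ _ h
  · exact (key _ _ _ _ _ _ _ _ h).symm

/-- Concatenation is well defined on homotopy classes. -/
theorem Homotopic.concat {f f' : A.Path a b} {g g' : A.Path b c} (H : Homotopic f f')
    (K : Homotopic g g') (N M N' M' : ℤ) (hN hM hN' hM') :
    Homotopic (f.concat g N M hN hM) (f'.concat g' N' M' hN' hM') := by
  obtain ⟨P, hP⟩ := concat_homotopic_left H g
  obtain ⟨Q, hQ⟩ := concat_homotopic_right f' K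
  have hf : ∀ n ≥ max P (max N N'), f.toFun n = b := fun n hn => hN n (by omega)
  have hf' : ∀ n ≥ max P (max N N'), f'.toFun n = b := fun n hn => hN' n (by omega)
  have hg : ∀ n ≤ min Q (min M M'), g.toFun n = b := fun n hn => hM n (by omega)
  have hg' : ∀ n ≤ min Q (min M M'), g'.toFun n = b := fun n hn => hM' n (by omega)
  refine (concat_homotopic_concat f g N M _ _ hN hM hf hg).trans ?_
  refine (hP _ (by omega) _ hf hf' hg).trans ?_
  refine (hQ _ (by omega) _ hf' hg hg').trans ?_
  exact concat_homotopic_concat f' g' _ _ _ _ hf' hg' hN' hM'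

/-- The constant path at a point which lies in some local set. -/
def Path.const (a : A) (h : ∃ α, a ∈ A.dom α) : A.Path a a :=
  Path.mk₂ (fun _ => a)
    (fun _ => by
      obtain ⟨α, hα⟩ := h
      refine ⟨α, ⟨a, hα⟩, fun y hy => ⟨1, ?_⟩⟩
      rw [one_smul]
      rcases hy with hy | hy <;> exact hy.symm)
    ⟨0, fun _ _ => rfl⟩ ⟨0, fun _ _ => rfl⟩

/-- The reverse of a path. -/
def Path.reverse (f : A.Path a b) : A.Path b a :=
  Path.mk₂ (fun n => f.toFun (-n))
    (fun n => by
      have := f.isLocal (-(n + 1))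
      have e : -(n + 1) + 1 = -n := by ring
      rw [e] at this
      rwa [Set.pair_comm])
    (by
      obtain ⟨N, hN⟩ := f.exists_right
      exact ⟨-N, fun n hn => hN _ (by omega)⟩)
    (by
      obtain ⟨N, hN⟩ := f.exists_left
      exact ⟨-N, fun n hn => hN _ (by omega)⟩)

theorem Path.reverse_toFun (f : A.Path a b) (n : ℤ) : f.reverse.toFun n = f.toFun (-n) := rfl

theorem Homotopic.reverse {f g : A.Path a b} (H : Homotopic f g) :
    Homotopic f.reverse g.reverse := by
  obtain ⟨h, H⟩ := H
  obtain ⟨N, M, -, h₁, h₂, h₃, h₄⟩ := H.stabilises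
  refine ⟨fun x => h (-x.1, x.2), isHomotopy_mk₂ (fun m n => ?_) ⟨N, fun n hn m => h₁ n hn _⟩
    ⟨M, fun n hn m => h₂ n hn _⟩ ⟨-M, fun m hm n => h₄ _ (by omega) n⟩
    ⟨-N, fun m hm n => h₃ _ (by omega) n⟩⟩
  refine (H.isLocal (-(m + 1)) n).mono ?_
  have e : -(m + 1) + 1 = -m := by ring
  rw [e]
  rintro y (rfl | rfl | rfl | rfl) <;> simp

theorem concat_const (f : A.Path a b) (h : ∃ α, b ∈ A.dom α) (N M : ℤ) (hN hM) :
    f.concat (Path.const b h) N M hN hM = f := by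
  refine Path.ext fun n => ?_
  rw [Path.concat_toFun]
  split_ifs
  · rfl
  · exact (hN _ (by omega)).symm

theorem const_concat (f : A.Path a b) (h : ∃ α, a ∈ A.dom α) (N : ℤ) (hN hM) :
    (Path.const a h).concat f N N hN hM = f := by
  refine Path.ext fun n => ?_
  rw [Path.concat_toFun]
  split_ifs with h1
  · exact (hM _ h1).symm
  · congr 1
    ring

theorem concat_assoc (f : A.Path a b) (g : A.Path b c) (k : A.Path c d) (N M N' M' : ℤ)
    (hN hM hN' hM' hR hL) (h : M ≤ N') :
    (f.concat g N M hN hM).concat k (N' - M + N) M' hR hM'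
      = f.concat (g.concat k N' M' hN' hM') N M hN hL := by
  refine Path.ext fun n => ?_
  simp only [Path.concat_toFun]
  by_cases h1 : n ≤ N
  · rw [if_pos (by omega), if_pos h1, if_pos h1]
  · by_cases h2 : n ≤ N' - M + N
    · rw [if_pos h2, if_neg h1, if_neg h1, if_pos (by omega)]
    · rw [if_neg h2, if_neg h1, if_neg (by omega)]
      congr 1
      ring

theorem concat_reverse_homotopic (f : A.Path a b) (h : ∃ α, a ∈ A.dom α) (N : ℤ) (hN hM) :
    Homotopic (f.concat f.reverse N (-N) hN hM) (Path.const a h) := by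
  refine Homotopic.symm ?_
  obtain ⟨P, hP⟩ := f.exists_left
  refine ⟨fun x => f.toFun (min (N - |x.1 - N|) x.2), isHomotopy_mk₂ (fun m n => ?_)
    ⟨P, fun n hn m => ?_⟩ ⟨N, fun n hn m => ?_⟩ ⟨P, fun m hm n => ?_⟩
    ⟨max N (2 * N - P), fun m hm n => ?_⟩⟩
  · obtain ⟨t, ht⟩ : ∃ t, N - |m - N| = t := ⟨_, rfl⟩
    obtain ⟨t', ht'⟩ : ∃ t, N - |m + 1 - N| = t := ⟨_, rfl⟩
    have htt : t' = t + 1 ∨ t = t' + 1 := by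
      rcases lt_or_ge m N with h1 | h1
      · rw [abs_of_nonpos (by omega)] at ht ht'
        omega
      · rw [abs_of_nonneg (by omega)] at ht ht'
        omega
    simp only [ht, ht']
    exact f.isLocal_square (min (min t t') n) (by omega) (by omega) (by omega) (by omega)
  · exact hP _ (by omega)
  · rw [Path.concat_toFun, Path.reverse_toFun]
    have h0 := abs_nonneg (m - N)
    dsimp only
    rw [min_eq_left (by omega)]
    split_ifs with h1
    · rw [abs_of_nonpos (by omega)]
      congr 1
      ring
    · rw [abs_of_nonneg (by omega)]
      congr 1
      ring
  · refine hP _ ?_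
    dsimp only
    have := neg_abs_le (m - N)
    have := le_abs_self (m - N)
    have := neg_le_abs (m - N)
    omega
  · refine hP _ ?_
    dsimp only
    have := le_abs_self (m - N)
    omega

end PathLemmas

/-! ### Homotopy classes and the fundamental group -/

/-- Fixed end point homotopy as an equivalence relation on the paths from `a` to `b`. -/
def pathSetoid (A : GlobalAction.{u, v, w}) (a b : A) : Setoid (A.Path a b) where
  r := Homotopic
  iseqv := ⟨Homotopic.refl, Homotopic.symm, Homotopic.trans⟩

/-- Fixed end point homotopy classes of paths from `a` to `b`. -/
def PathClass (A : GlobalAction.{u, v, w}) (a b : A) : Type u :=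
  Quotient (A.pathSetoid a b)

namespace PathClass

variable {A : GlobalAction.{u, v, w}} {a b c d : A}

/-- The homotopy class of a path. -/
def mk (f : A.Path a b) : A.PathClass a b := Quotient.mk (A.pathSetoid a b) f

theorem mk_eq_mk_iff {f g : A.Path a b} : mk f = mk g ↔ Homotopic f g :=
  ⟨fun h => Quotient.exact h, fun h => Quotient.sound (s := A.pathSetoid a b) h⟩

theorem mk_surjective (x : A.PathClass a b) : ∃ f, mk f = x := Quotient.exists_rep x

/-- Concatenation of homotopy classes. -/
noncomputable def comp : A.PathClass a b → A.PathClass b c → A.PathClass a c :=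
  Quotient.lift₂ (s₁ := A.pathSetoid a b) (s₂ := A.pathSetoid b c)
    (fun f g => mk (f.concat g f.exists_right.choose g.exists_left.choose
      f.exists_right.choose_spec g.exists_left.choose_spec))
    (fun _ _ _ _ H K => mk_eq_mk_iff.2 (Homotopic.concat H K _ _ _ _ _ _ _ _))

/-- Concatenation of homotopy classes may be computed with any choice of stabilisation
positions. -/
theorem mk_comp_mk (f : A.Path a b) (g : A.Path b c) (N M : ℤ) (hN hM) :
    (mk f).comp (mk g) = mk (f.concat g N M hN hM) :=
  mk_eq_mk_iff.2 (concat_homotopic_concat f g _ _ _ _ _ _ _ _)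

/-- The class of the constant path. -/
def const (a : A) (h : ∃ α, a ∈ A.dom α) : A.PathClass a a := mk (Path.const a h)

/-- Reversal of homotopy classes. -/
def reverse : A.PathClass a b → A.PathClass b a :=
  Quotient.lift (s := A.pathSetoid a b) (fun f => mk f.reverse)
    (fun _ _ H => mk_eq_mk_iff.2 (Homotopic.reverse H))

theorem reverse_mk (f : A.Path a b) : (mk f).reverse = mk f.reverse := rfl

theorem comp_const (x : A.PathClass a b) (h : ∃ α, b ∈ A.dom α) : x.comp (const b h) = x := by
  obtain ⟨f, rfl⟩ := mk_surjective x
  obtain ⟨N, hN⟩ := f.exists_right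
  have hM : ∀ n ≤ (0 : ℤ), (Path.const b h).toFun n = b := fun _ _ => rfl
  rw [const, mk_comp_mk f _ N 0 hN hM, concat_const]

theorem const_comp (x : A.PathClass a b) (h : ∃ α, a ∈ A.dom α) : (const a h).comp x = x := by
  obtain ⟨f, rfl⟩ := mk_surjective x
  obtain ⟨N, hN⟩ := f.exists_left
  have hM : ∀ n ≥ N, (Path.const a h).toFun n = a := fun _ _ => rfl
  rw [const, mk_comp_mk _ f N N hM hN, const_concat]

theorem comp_assoc (x : A.PathClass a b) (y : A.PathClass b c) (z : A.PathClass c d) :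
    (x.comp y).comp z = x.comp (y.comp z) := by
  obtain ⟨f, rfl⟩ := mk_surjective x
  obtain ⟨g, rfl⟩ := mk_surjective y
  obtain ⟨k, rfl⟩ := mk_surjective z
  obtain ⟨N, hN⟩ := f.exists_right
  obtain ⟨M, hM⟩ := g.exists_left
  obtain ⟨N', hN'⟩ := g.exists_right
  obtain ⟨M', hM'⟩ := k.exists_left
  have hN'' : ∀ n ≥ max M N', g.toFun n = c := fun n hn => hN' n (by omega)
  have hR : ∀ n ≥ max M N' - M + N, (f.concat g N M hN hM).toFun n = c := by
    intro n hn
    rw [Path.concat_toFun]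
    split_ifs with h1
    · obtain rfl : n = N := by omega
      have e : max M N' = M := by omega
      rw [hN _ le_rfl, ← hM M le_rfl]
      exact hN'' M (by omega)
    · exact hN'' _ (by omega)
  have hL : ∀ n ≤ M, (g.concat k (max M N') M' hN'' hM').toFun n = b := by
    intro n hn
    rw [Path.concat_toFun, if_pos (by omega)]
    exact hM n hn
  rw [mk_comp_mk f g N M hN hM, mk_comp_mk g k (max M N') M' hN'' hM',
    mk_comp_mk _ k (max M N' - M + N) M' hR hM', mk_comp_mk f _ N M hN hL,
    concat_assoc f g k N M (max M N') M' hN hM hN'' hM' hR hL (by omega)]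

theorem comp_reverse (x : A.PathClass a b) (h : ∃ α, a ∈ A.dom α) :
    x.comp x.reverse = const a h := by
  obtain ⟨f, rfl⟩ := mk_surjective x
  obtain ⟨N, hN⟩ := f.exists_right
  have hM : ∀ n ≤ -N, f.reverse.toFun n = b := fun n hn => hN _ (by omega)
  rw [reverse_mk, mk_comp_mk f _ N (-N) hN hM]
  exact mk_eq_mk_iff.2 (concat_reverse_homotopic f h N hN hM)

theorem reverse_reverse (x : A.PathClass a b) : x.reverse.reverse = x := by
  obtain ⟨f, rfl⟩ := mk_surjective x
  rw [reverse_mk, reverse_mk]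
  congr 1
  refine Path.ext fun n => ?_
  rw [Path.reverse_toFun, Path.reverse_toFun, neg_neg]

theorem reverse_comp (x : A.PathClass a b) (h : ∃ α, b ∈ A.dom α) :
    x.reverse.comp x = const b h := by
  have := comp_reverse x.reverse h
  rwa [reverse_reverse] at this

end PathClass

/-- A global action is covered if every point lies in some local set. -/
class IsCovered (A : GlobalAction.{u, v, w}) : Prop where
  exists_mem_dom : ∀ a : A, ∃ α, a ∈ A.dom α

/-- The fundamental group: homotopy classes of loops at `a`. -/
def FundamentalGroup (A : GlobalAction.{u, v, w}) (a : A) : Type u := A.PathClass a a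

/-- Multiplication in the fundamental group is concatenation of loops (first `x`, then `y`). -/
noncomputable instance (A : GlobalAction.{u, v, w}) [A.IsCovered] (a : A) :
    Group (A.FundamentalGroup a) where
  mul x y := PathClass.comp x y
  one := PathClass.const a (IsCovered.exists_mem_dom a)
  inv x := PathClass.reverse x
  mul_assoc x y z := PathClass.comp_assoc x y z
  one_mul x := PathClass.const_comp x _
  mul_one x := PathClass.comp_const x _
  inv_mul_cancel x := PathClass.reverse_comp x _

/-- A global action is connected if it is non-empty and any two points are joined by a path. -/
def IsConnected (A : GlobalAction.{u, v, w}) : Prop :=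
  Nonempty A ∧ ∀ a b : A, Nonempty (A.Path a b)

/-- A global action is simply connected if it is connected and its fundamental groups are
trivial. -/
def IsSimplyConnected (A : GlobalAction.{u, v, w}) : Prop :=
  A.IsConnected ∧ ∀ a : A, Subsingleton (A.FundamentalGroup a)

/-! ### The universal covering constructed from based paths -/

section Link

variable {A : GlobalAction.{u, v, w}} {x y z : A}

/-- The one-step path between two points of a local orbit. -/
def Path.link (x y : A) (h : A.IsLocal {x, y}) : A.Path x y :=
  Path.mk₂ (fun n => if n ≤ 0 then x else y)
    (fun n => by
      refine h.mono ?_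
      rintro t (rfl | rfl) <;> split_ifs <;> simp)
    ⟨0, fun _ hn => if_pos hn⟩ ⟨1, fun _ hn => if_neg (by omega)⟩

theorem Path.link_toFun (h : A.IsLocal {x, y}) (n : ℤ) :
    (Path.link x y h).toFun n = if n ≤ 0 then x else y := rfl

/-- The class of the one-step path between two points of a local orbit. -/
def PathClass.link (x y : A) (h : A.IsLocal {x, y}) : A.PathClass x y :=
  PathClass.mk (Path.link x y h)

theorem PathClass.link_self (h : A.IsLocal {x, x}) (h' : ∃ α, x ∈ A.dom α) :
    PathClass.link x x h = PathClass.const x h' := by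
  unfold PathClass.link PathClass.const
  congr 1
  refine Path.ext fun n => ?_
  rw [Path.link_toFun, ite_self]
  rfl

theorem PathClass.link_comp_link (hxyz : A.IsLocal {x, y, z}) (hxy : A.IsLocal {x, y})
    (hyz : A.IsLocal {y, z}) (hxz : A.IsLocal {x, z}) :
    (PathClass.link x y hxy).comp (PathClass.link y z hyz) = PathClass.link x z hxz := by
  have hN : ∀ n ≥ (1 : ℤ), (Path.link x y hxy).toFun n = y := fun n hn => if_neg (by omega)
  have hM : ∀ n ≤ (0 : ℤ), (Path.link y z hyz).toFun n = y := fun n hn => if_pos hn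
  unfold PathClass.link
  rw [mk_comp_mk _ _ 1 0 hN hM, mk_eq_mk_iff]
  refine ⟨fun t => if t.1 ≤ 0 then x else if t.1 = 1 ∧ t.2 ≤ 0 then y else z,
    isHomotopy_mk₂ (fun m n => hxyz.mono ?_) ⟨0, fun n hn m => ?_⟩ ⟨1, fun n hn m => ?_⟩
    ⟨0, fun m hm n => if_pos hm⟩ ⟨2, fun m hm n => ?_⟩⟩
  · rintro t (rfl | rfl | rfl | rfl) <;> dsimp only <;> split_ifs <;> simp
  · rw [Path.concat_toFun, Path.link_toFun, Path.link_toFun]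
    dsimp only
    split_ifs <;> first | rfl | (exfalso; omega)
  · rw [Path.link_toFun]
    dsimp only
    split_ifs <;> first | rfl | (exfalso; omega)
  · dsimp only
    rw [if_neg (by omega), if_neg (by omega)]

theorem isLocal_smul (α : A.Coord) (σ : A.Grp α) (x : A.dom α) :
    A.IsLocal {(x : A), ((σ • x : A.dom α) : A)} := by
  refine ⟨α, x, ?_⟩
  rintro _ (rfl | rfl)
  · exact ⟨1, by rw [one_smul]⟩
  · exact ⟨σ, rfl⟩

theorem isLocal_smul_smul (α : A.Coord) (σ τ : A.Grp α) (x : A.dom α) :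
    A.IsLocal {(x : A), ((σ • x : A.dom α) : A), ((τ • σ • x : A.dom α) : A)} := by
  refine ⟨α, x, ?_⟩
  rintro _ (rfl | rfl | rfl)
  · exact ⟨1, by rw [one_smul]⟩
  · exact ⟨σ, rfl⟩
  · exact ⟨τ * σ, by rw [mul_smul]⟩

end Link

/-- The action of a local group on homotopy classes of paths starting at `a` and ending in its
local set: `σ` appends to the path the one-step path from its end point `x` to `σ • x`. -/
noncomputable def appendLink (A : GlobalAction.{u, v, w}) (a : A) (α : A.Coord) (σ : A.Grp α)
    (x : {x : Σ b : A, A.PathClass a b // x.1 ∈ A.dom α}) :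
    {x : Σ b : A, A.PathClass a b // x.1 ∈ A.dom α} :=
  ⟨⟨((σ • (⟨x.1.1, x.2⟩ : A.dom α) : A.dom α) : A),
    x.1.2.comp (PathClass.link x.1.1 _ (isLocal_smul α σ ⟨x.1.1, x.2⟩))⟩,
    (σ • (⟨x.1.1, x.2⟩ : A.dom α)).2⟩

theorem sigma_comp_link_congr {A : GlobalAction.{u, v, w}} {a b c c' : A} (x : A.PathClass a b)
    (h : c = c') (hc : A.IsLocal {b, c}) (hc' : A.IsLocal {b, c'}) :
    (⟨c, x.comp (PathClass.link b c hc)⟩ : Σ b : A, A.PathClass a b)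
      = ⟨c', x.comp (PathClass.link b c' hc')⟩ := by
  subst h
  rfl

/-- The universal covering of `A` at the base point `a`: its points are the fixed end point
homotopy classes of paths starting at `a`, its coordinate system and local groups are those of `A`,
and the local groups act by appending one-step paths. -/
noncomputable abbrev universalCovering (A : GlobalAction.{u, v, w}) (a : A) :
    GlobalAction.{u, v, w} where
  carrier := Σ b : A, A.PathClass a b
  Coord := A.Coord
  le := A.le
  le_refl := A.le_refl
  dom α := {x | x.1 ∈ A.dom α}
  Grp := A.Grp
  action α :=
    { smul := A.appendLink a α
      one_smul := fun x => Subtype.ext (by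
        obtain ⟨⟨b, y⟩, hb⟩ := x
        have hbb : A.IsLocal {b, b} := by
          have := isLocal_smul α 1 (⟨b, hb⟩ : A.dom α)
          rwa [one_smul] at this
        refine (sigma_comp_link_congr y
          (congrArg Subtype.val (one_smul (A.Grp α) (⟨b, hb⟩ : A.dom α))) _ hbb).trans ?_
        rw [PathClass.link_self hbb ⟨α, hb⟩, PathClass.comp_const])
      mul_smul := fun τ σ x => Subtype.ext (by
        obtain ⟨⟨b, y⟩, hb⟩ := x
        have h3 := isLocal_smul_smul α σ τ (⟨b, hb⟩ : A.dom α)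
        have h13 : A.IsLocal {b, ((τ • σ • (⟨b, hb⟩ : A.dom α) : A.dom α) : A)} := by
          refine h3.mono ?_
          rintro t (rfl | rfl) <;> simp
        refine (sigma_comp_link_congr y
          (congrArg Subtype.val (mul_smul τ σ (⟨b, hb⟩ : A.dom α))) _ h13).trans ?_
        refine congrArg (Sigma.mk _) ?_
        rw [← PathClass.link_comp_link h3 (isLocal_smul α σ ⟨b, hb⟩)
          (isLocal_smul α τ (σ • ⟨b, hb⟩)) h13, ← PathClass.comp_assoc]
        rfl) }
  map := A.map
  smul_mem h σ x hx := A.smul_mem h σ ⟨x.1.1, x.2⟩ hx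
  smul_eq h σ x hα hβ := sigma_comp_link_congr x.2 (A.smul_eq h σ x.1 hα hβ) _ _

/-- The end point projection of the universal covering. -/
def universalCoveringMap (A : GlobalAction.{u, v, w}) (a : A) (x : A.universalCovering a) : A := x.1

/-- The base point of the universal covering: the class of the constant path. -/
def universalCoveringBase (A : GlobalAction.{u, v, w}) [A.IsCovered] (a : A) :
    A.universalCovering a := ⟨a, PathClass.const a (IsCovered.exists_mem_dom a)⟩

/-! ### Single domain global actions given by translations -/

/-- The single domain global action on the underlying set of a group `G` in which the local groups
`H α`, indexed by a preordered set `Φ`, act by left multiplication through homomorphisms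
`ι α : H α →* G`. -/
abbrev translationAction (G : Type u) [Group G] (Φ : Type v) [Preorder Φ] (H : Φ → Type w)
    [∀ α, Group (H α)] (ι : ∀ α, H α →* G) (map : ∀ {α β : Φ}, α ≤ β → (H α →* H β))
    (ι_map : ∀ {α β : Φ} (h : α ≤ β) (σ : H α), ι β (map h σ) = ι α σ) :
    GlobalAction.{u, v, w} where
  carrier := G
  Coord := Φ
  le α β := α ≤ β
  le_refl := _root_.le_refl
  dom _ := Set.univ
  Grp := H
  action α :=
    { smul := fun σ x => ⟨ι α σ * x.1, trivial⟩
      one_smul := fun x => Subtype.ext (by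
        change ι α 1 * x.1 = x.1
        rw [map_one, one_mul])
      mul_smul := fun σ τ x => Subtype.ext (by
        change ι α (σ * τ) * x.1 = ι α σ * (ι α τ * x.1)
        rw [map_mul, mul_assoc]) }
  map := map
  smul_mem _ _ _ _ := trivial
  smul_eq h σ x _ _ := by
    change ι _ σ * x = ι _ (map h σ) * x
    rw [ι_map]

end GlobalAction

/-! ### Elementary matrices and the Steinberg group -/

section LinearGroups

open scoped commutatorElement

variable (n : ℕ) (R : Type u) [Ring R]

/-- The set of off-diagonal positions in an `n × n` array. -/
def offDiagonal : Set (Fin n × Fin n) := {p | p.1 ≠ p.2}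

/-- The closed sets of off-diagonal positions, ordered by inclusion. -/
abbrev ClosedSet : Type :=
  {α : Set (Fin n × Fin n) // α ⊆ offDiagonal n ∧
    ∀ i j k, (i, j) ∈ α → (j, k) ∈ α → (i, k) ∈ α}

variable {n R}

theorem single_mul_single_off {i j : Fin n} (h : i ≠ j) (a b : R) :
    Matrix.single i j a * Matrix.single i j b = 0 :=
  Matrix.single_mul_single_of_ne a i j i h.symm b

/-- The elementary matrix with `r` in position `(i, j)`, as an invertible matrix. -/
def elementary (i j : Fin n) (h : i ≠ j) (r : R) : Matrix.GeneralLinearGroup (Fin n) R where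
  val := 1 + Matrix.single i j r
  inv := 1 - Matrix.single i j r
  val_inv := by
    rw [mul_sub, mul_one, add_mul, one_mul, single_mul_single_off h, add_zero, add_sub_cancel_right]
  inv_val := by
    rw [sub_mul, one_mul, mul_add, mul_one, single_mul_single_off h, add_zero, add_sub_cancel_right]

theorem elementary_mul (i j : Fin n) (h : i ≠ j) (a b : R) :
    elementary i j h a * elementary i j h b = elementary i j h (a + b) := by
  apply Units.ext
  change (1 + Matrix.single i j a) * (1 + Matrix.single i j b) = 1 + Matrix.single i j (a + b)
  rw [add_mul, mul_add, mul_add, one_mul, one_mul, mul_one, single_mul_single_off h, add_zero,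
    Matrix.single_add]
  abel

theorem elementary_commute (i j k l : Fin n) (h : i ≠ j) (h' : k ≠ l) (hil : i ≠ l) (hjk : j ≠ k)
    (a b : R) : ⁅elementary i j h a, elementary k l h' b⁆ = 1 := by
  rw [commutatorElement_eq_one_iff_mul_comm]
  apply Units.ext
  change (1 + Matrix.single i j a) * (1 + Matrix.single k l b)
    = (1 + Matrix.single k l b) * (1 + Matrix.single i j a)
  have e1 : Matrix.single i j a * Matrix.single k l b = 0 :=
    Matrix.single_mul_single_of_ne a i j k hjk b
  have e2 : Matrix.single k l b * Matrix.single i j a = 0 :=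
    Matrix.single_mul_single_of_ne b k l i hil.symm a
  simp only [add_mul, mul_add, one_mul, mul_one, e1, e2]
  abel

theorem elementary_commutator (i j l : Fin n) (h : i ≠ j) (h' : j ≠ l) (hil : i ≠ l) (a b : R) :
    ⁅elementary i j h a, elementary j l h' b⁆ = elementary i l hil (a * b) := by
  rw [commutatorElement_def, mul_inv_eq_iff_eq_mul, mul_inv_eq_iff_eq_mul]
  apply Units.ext
  change (1 + Matrix.single i j a) * (1 + Matrix.single j l b)
    = (1 + Matrix.single i l (a * b)) * (1 + Matrix.single j l b) * (1 + Matrix.single i j a)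
  have e1 : Matrix.single i j a * Matrix.single j l b = Matrix.single i l (a * b) :=
    Matrix.single_mul_single_same a i j l b
  have e2 : Matrix.single j l b * Matrix.single i j a = 0 :=
    Matrix.single_mul_single_of_ne b j l i hil.symm a
  have e3 : Matrix.single i l (a * b) * Matrix.single j l b = 0 :=
    Matrix.single_mul_single_of_ne _ i l j h'.symm b
  have e4 : Matrix.single i l (a * b) * Matrix.single i j a = 0 :=
    Matrix.single_mul_single_of_ne _ i l i hil.symm a
  simp only [add_mul, mul_add, one_mul, mul_one, e1, e2, e3, e4, zero_mul]
  abel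

/-- The Steinberg relations between generators `x_p(r)`, where `p` ranges over a set `S` of
positions and `r` over the ring: those of the usual Steinberg relations in which only positions
in `S` occur. The generator `x_p(r)` is the pair `(p, r)`. -/
inductive SteinbergRel (S : Set (Fin n × Fin n)) : FreeGroup (S × R) → Prop
  | additive (p : S) (a b : R) : SteinbergRel S
      (FreeGroup.of (p, a) * FreeGroup.of (p, b) * (FreeGroup.of (p, a + b))⁻¹)
  | commute (i j k l : Fin n) (h : (i, j) ∈ S) (h' : (k, l) ∈ S) (a b : R) :
      i ≠ l → j ≠ k → SteinbergRel S
        ⁅FreeGroup.of ((⟨(i, j), h⟩ : S), a), FreeGroup.of ((⟨(k, l), h'⟩ : S), b)⁆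
  | commutator (i j l : Fin n) (h : (i, j) ∈ S) (h' : (j, l) ∈ S) (h'' : (i, l) ∈ S) (a b : R) :
      i ≠ l → SteinbergRel S
        (⁅FreeGroup.of ((⟨(i, j), h⟩ : S), a), FreeGroup.of ((⟨(j, l), h'⟩ : S), b)⁆
          * (FreeGroup.of ((⟨(i, l), h''⟩ : S), a * b))⁻¹)

variable (R) in
/-- The group presented by the generators `x_p(r)`, for `p ∈ S` and `r ∈ R`, and the Steinberg
relations between them. -/
abbrev SteinbergOn (S : Set (Fin n × Fin n)) : Type u :=
  PresentedGroup {w : FreeGroup (S × R) | SteinbergRel S w}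

variable (n R) in
/-- The Steinberg group `St_n(R)`. -/
abbrev Steinberg : Type u := SteinbergOn R (offDiagonal n)

/-- The evaluation homomorphism, sending `x_{ij}(r)` to the corresponding elementary matrix. -/
def SteinbergOn.eval (S : Set (Fin n × Fin n)) (hS : S ⊆ offDiagonal n) :
    SteinbergOn R S →* Matrix.GeneralLinearGroup (Fin n) R :=
  PresentedGroup.toGroup (f := fun x : S × R => elementary x.1.1.1 x.1.1.2 (hS x.1.2) x.2) (by
    intro w hw
    cases hw with
    | additive p a b =>
      simp only [map_mul, map_inv, FreeGroup.lift_apply_of]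
      exact mul_inv_eq_one.2 (elementary_mul _ _ _ a b)
    | commute i j k l h h' a b hil hjk =>
      simp only [map_commutatorElement, FreeGroup.lift_apply_of]
      exact elementary_commute i j k l _ _ hil hjk a b
    | commutator i j l h h' h'' a b hil =>
      simp only [map_mul, map_inv, map_commutatorElement, FreeGroup.lift_apply_of]
      exact mul_inv_eq_one.2 (elementary_commutator i j l _ _ hil a b))

/-- For `S ⊆ T`, the homomorphism of Steinberg groups sending each generator to the generator of
the same name. -/
def SteinbergOn.incl {S T : Set (Fin n × Fin n)} (h : S ⊆ T) : SteinbergOn R S →* SteinbergOn R T :=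
  PresentedGroup.toGroup
    (f := fun x : S × R => PresentedGroup.of ((⟨x.1.1, h x.1.2⟩ : T), x.2)) (by
    intro w hw
    cases hw with
    | additive p a b =>
      simp only [map_mul, map_inv, FreeGroup.lift_apply_of]
      exact PresentedGroup.one_of_mem (SteinbergRel.additive (⟨p.1, h p.2⟩ : T) a b)
    | commute i j k l h1 h2 a b hil hjk =>
      simp only [map_commutatorElement, FreeGroup.lift_apply_of]
      exact PresentedGroup.one_of_mem (SteinbergRel.commute i j k l (h h1) (h h2) a b hil hjk)
    | commutator i j l h1 h2 h3 a b hil =>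
      simp only [map_mul, map_inv, map_commutatorElement, FreeGroup.lift_apply_of]
      exact PresentedGroup.one_of_mem
        (SteinbergRel.commutator i j l (h h1) (h h2) (h h3) a b hil))

theorem SteinbergOn.incl_incl {S T U : Set (Fin n × Fin n)} (h : S ⊆ T) (h' : T ⊆ U)
    (x : SteinbergOn R S) : incl h' (incl h x) = incl (h.trans h') x := by
  have : (incl h').comp (incl h) = (incl (h.trans h') : SteinbergOn R S →* _) := by
    refine PresentedGroup.ext fun x => ?_
    simp only [incl, MonoidHom.comp_apply, PresentedGroup.toGroup.of]
  exact DFunLike.congr_fun this x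

variable (R) in
/-- The subgroup of the general linear group generated by the elementary matrices with
off-diagonal entry in a position of `S`. -/
def elementarySubgroup (S : Set (Fin n × Fin n)) :
    Subgroup (Matrix.GeneralLinearGroup (Fin n) R) :=
  Subgroup.closure {g | ∃ (i j : Fin n) (h : i ≠ j) (r : R), (i, j) ∈ S ∧ g = elementary i j h r}

theorem elementarySubgroup_mono {S T : Set (Fin n × Fin n)} (h : S ⊆ T) :
    elementarySubgroup R S ≤ elementarySubgroup R T := by
  refine Subgroup.closure_mono ?_
  rintro _ ⟨i, j, hij, r, hS, rfl⟩
  exact ⟨i, j, hij, r, h hS, rfl⟩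

variable (n R)

/-- The elementary group `E_n(R)`, generated by all elementary matrices. -/
abbrev elementaryGroup : Subgroup (Matrix.GeneralLinearGroup (Fin n) R) :=
  elementarySubgroup R (offDiagonal n)

theorem eval_mem_elementaryGroup (x : Steinberg n R) :
    SteinbergOn.eval (offDiagonal n) subset_rfl x ∈ elementaryGroup n R := by
  have : (⊤ : Subgroup (Steinberg n R))
      ≤ (elementaryGroup n R).comap (SteinbergOn.eval (offDiagonal n) subset_rfl) := by
    rw [← PresentedGroup.closure_range_of, Subgroup.closure_le]
    rintro _ ⟨⟨⟨⟨i, j⟩, h⟩, r⟩, rfl⟩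
    change SteinbergOn.eval _ _ _ ∈ elementaryGroup n R
    rw [SteinbergOn.eval, PresentedGroup.toGroup.of]
    exact Subgroup.subset_closure ⟨i, j, h, r, h, rfl⟩
  exact this (Subgroup.mem_top x)

/-- The evaluation homomorphism from the Steinberg group to the general linear group. -/
def steinbergEval : Steinberg n R →* Matrix.GeneralLinearGroup (Fin n) R :=
  SteinbergOn.eval (offDiagonal n) subset_rfl

/-- The evaluation homomorphism from the Steinberg group to the elementary group. -/
def steinbergToElementary : Steinberg n R →* elementaryGroup n R :=
  (steinbergEval n R).codRestrict (elementaryGroup n R) (eval_mem_elementaryGroup n R)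

/-- The unstable `K`-group `K_2(n, R)`: the kernel of `St_n(R) → E_n(R)`. -/
abbrev KTwo : Subgroup (Steinberg n R) := (steinbergToElementary n R).ker

/-! ### The general linear, elementary and Steinberg global actions -/

/-- The general linear global action. -/
abbrev generalLinearAction : GlobalAction.{u, 0, u} :=
  GlobalAction.translationAction (Matrix.GeneralLinearGroup (Fin n) R) (ClosedSet n)
    (fun α => elementarySubgroup R α.1) (fun α => (elementarySubgroup R α.1).subtype)
    (fun h => Subgroup.inclusion (elementarySubgroup_mono h)) (fun _ _ => rfl)

/-- The elementary global action: the part of the general linear global action with underlying set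
the elementary group. -/
abbrev elementaryAction : GlobalAction.{u, 0, u} :=
  GlobalAction.translationAction (elementaryGroup n R) (ClosedSet n)
    (fun α => elementarySubgroup R α.1)
    (fun α => Subgroup.inclusion (elementarySubgroup_mono α.2.1))
    (fun h => Subgroup.inclusion (elementarySubgroup_mono h)) (fun _ _ => rfl)

/-- The Steinberg global action: the local group at a closed set `α` is the group presented by the
generators `x_p(r)`, `p ∈ α`, and the Steinberg relations between them. -/
abbrev steinbergAction : GlobalAction.{u, 0, u} :=
  GlobalAction.translationAction (Steinberg n R) (ClosedSet n)
    (fun α => SteinbergOn R α.1) (fun α => SteinbergOn.incl α.2.1)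
    (fun h => SteinbergOn.incl h) (fun _ _ => SteinbergOn.incl_incl _ _ _)

instance : (generalLinearAction n R).IsCovered :=
  ⟨fun _ => ⟨⟨∅, Set.empty_subset _, fun _ _ _ h => h.elim⟩, trivial⟩⟩

instance : (steinbergAction n R).IsCovered :=
  ⟨fun _ => ⟨⟨∅, Set.empty_subset _, fun _ _ _ h => h.elim⟩, trivial⟩⟩

end LinearGroups

section LinearGroups

open scoped commutatorElement

variable {n : ℕ} {R : Type u} [Ring R]

/-! ### Steinberg groups of closed sets are unipotent matrix groups -/

/-! Two facts about closed sets carry the proof.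

The first is rigidity. For a closed set α, evaluation identifies St_α with the group of all
invertible matrices that agree with the identity outside α
(`SteinbergOn.eval_injective_and_exists`). The induction removes from α a position p that is not
composed of two others, so that the rest is still closed. Every element of St_α is x_p(r) times an
element of the smaller group, and r is read off as the matrix entry at p. Since the image is
described by a pattern of entries, a matrix coming from both St_α and St_β comes from St_{α ∩ β}, so
its two preimages agree in St_n(R) (`SteinbergOn.incl_eq_incl_of_eval_eq`). This is unique lifting
of local frames, also between lifts that use different coordinates, and it makes evaluation a
covering.

The second is that each Steinberg relation involves only the positions of some closed set, so
St_n(R) is the colimit of the St_α (`Steinberg.exists_hom`). Compatible actions of the local groups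
on any set therefore glue to an action of St_n(R). This is applied three times. On the universal
covering of the Steinberg action at a, the glued action is transitive and x moves the base point to
a class ending at xa. A class of paths is thus determined by its end point, which is simple
connectivity. On the universal covering of the general linear action, the orbit map of the base
point is onto. It is injective because lifts of homotopic paths along a covering end at the same
point (`IsCovering.end_eq_of_homotopic`). On an arbitrary covering with a base point over 1, the
orbit map is the universal morphism.

Over the identity matrix the orbit map becomes a bijection from K_2(n, R) to classes of loops. The
Steinberg group appends to paths while loops are put in front, so this bijection reverses products,
and inversion corrects it. -/

theorem ne_of_mem_offDiagonal {p : Fin n × Fin n} (h : p ∈ offDiagonal n) : p.1 ≠ p.2 := h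

theorem ClosedSet.ne (α : ClosedSet n) {i j : Fin n} (h : (i, j) ∈ α.1) : i ≠ j := α.2.1 h

/-! ### Generators and normal forms in the Steinberg group of a closed set. -/

namespace SteinbergOn

variable {S T : Set (Fin n × Fin n)}

/-- The generator `x_p(r)`. -/
def gen (p : S) (r : R) : SteinbergOn R S := PresentedGroup.of (p, r)

theorem gen_mul_gen (p : S) (a b : R) : gen p a * gen p b = gen p (a + b) :=
  mul_inv_eq_one.1 (PresentedGroup.one_of_mem (SteinbergRel.additive p a b))

theorem gen_zero (p : S) : gen p (0 : R) = 1 := by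
  have h := gen_mul_gen p (0 : R) 0
  rwa [add_zero, mul_eq_left] at h

theorem gen_inv (p : S) (r : R) : (gen p r)⁻¹ = gen p (-r) :=
  inv_eq_of_mul_eq_one_right (by rw [gen_mul_gen, add_neg_cancel, gen_zero])

theorem commutator_gen_gen_eq_one {i j k l : Fin n} (h : (i, j) ∈ S) (h' : (k, l) ∈ S) (a b : R)
    (hil : i ≠ l) (hjk : j ≠ k) : ⁅gen ⟨(i, j), h⟩ a, gen ⟨(k, l), h'⟩ b⁆ = 1 :=
  PresentedGroup.one_of_mem (SteinbergRel.commute i j k l h h' a b hil hjk)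

theorem commutator_gen_gen {i j l : Fin n} (h : (i, j) ∈ S) (h' : (j, l) ∈ S) (h'' : (i, l) ∈ S)
    (a b : R) (hil : i ≠ l) :
    ⁅gen ⟨(i, j), h⟩ a, gen ⟨(j, l), h'⟩ b⁆ = gen ⟨(i, l), h''⟩ (a * b) :=
  mul_inv_eq_one.1 (PresentedGroup.one_of_mem (SteinbergRel.commutator i j l h h' h'' a b hil))

theorem incl_gen (h : S ⊆ T) (p : S) (r : R) :
    incl h (gen p r) = gen (⟨p.1, h p.2⟩ : T) r := by
  simp only [incl, gen, PresentedGroup.toGroup.of]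

theorem eval_gen (hS : S ⊆ offDiagonal n) (p : S) (r : R) :
    eval S hS (gen p r) = elementary p.1.1 p.1.2 (ne_of_mem_offDiagonal (hS p.2)) r := by
  simp only [eval, gen, PresentedGroup.toGroup.of]

theorem hom_ext {M : Type*} [Group M] {f g : SteinbergOn R S →* M}
    (h : ∀ p r, f (gen p r) = g (gen p r)) : f = g :=
  by
  refine PresentedGroup.ext fun x => ?_
  exact h x.1 x.2

theorem eval_incl (h : S ⊆ T) (hT : T ⊆ offDiagonal n) (x : SteinbergOn R S) :
    eval T hT (incl h x) = eval S (h.trans hT) x := by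
  have : (eval T hT).comp (incl h) = (eval S (h.trans hT) : SteinbergOn R S →* _) :=
    hom_ext fun p r => by rw [MonoidHom.comp_apply, incl_gen, eval_gen, eval_gen]
  exact DFunLike.congr_fun this x

/-- The inverse of x_p(r) is the generator x_p(-r), so left multiplication by generators alone
reaches every element. -/
theorem induction_left {P : SteinbergOn R S → Prop} (one : P 1)
    (gen_mul : ∀ p r x, P x → P (gen p r * x)) (x : SteinbergOn R S) : P x := by
  have hx : x ∈ Subgroup.closure (Set.range (PresentedGroup.of
      (rels := {w : FreeGroup (S × R) | SteinbergRel S w}))) := by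
    rw [PresentedGroup.closure_range_of]
    exact Subgroup.mem_top x
  induction hx using Subgroup.closure_induction_left with
  | one => exact one
  | mul_left y hy z _ ih =>
    obtain ⟨⟨p, r⟩, rfl⟩ := hy
    exact gen_mul p r z ih
  | inv_mul_cancel y hy z _ ih =>
    obtain ⟨⟨p, r⟩, rfl⟩ := hy
    change P ((gen p r)⁻¹ * z)
    rw [gen_inv]
    exact gen_mul p (-r) z ih

/-- Conjugating a generator by a generator in a different position of a closed set does not
produce a generator in the latter position. -/
theorem exists_gen_mul_gen_eq {α : ClosedSet n} (p : α.1) (h : α.1 \ {p.1} ⊆ α.1)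
    (q : ↥(α.1 \ {p.1})) (a r : R) :
    ∃ s : SteinbergOn R (α.1 \ {p.1}), gen (⟨q.1, h q.2⟩ : α.1) a * gen p r = gen p r * incl h s := by
  obtain ⟨⟨m, j⟩, hp⟩ := p
  obtain ⟨⟨k, l⟩, hq, hne⟩ := q
  have hmj : m ≠ j := α.2.1 hp
  have hkl : k ≠ l := α.2.1 hq
  -- With x = x_q(a) and y = x_p(r), one has xy = yx · [x⁻¹, y⁻¹], so it is enough that this
  -- commutator avoids the position p. It is trivial, a generator, or the inverse of one, and the
  -- new position differs from p in its row or its column. The cases l = m and k = j exclude each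
  -- other, because a closed set contains no diagonal position.
  suffices ∃ s : SteinbergOn R (α.1 \ {(m, j)}),
      ⁅gen ⟨(k, l), hq⟩ (-a), gen ⟨(m, j), hp⟩ (-r)⁆ = incl h s by
    obtain ⟨s, hs⟩ := this
    refine ⟨gen (S := α.1 \ {(m, j)}) ⟨(k, l), hq, hne⟩ a * s, ?_⟩
    rw [map_mul, incl_gen, ← hs, commutatorElement_def, ← gen_inv, ← gen_inv]
    group
  by_cases hlm : l = m
  · subst hlm
    have hkj : (k, j) ∈ α.1 := α.2.2 _ _ _ hq hp
    refine ⟨gen ⟨(k, j), hkj, fun e => hkl (congrArg Prod.fst e)⟩ (-a * -r), ?_⟩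
    rw [incl_gen, commutator_gen_gen hq hp hkj _ _ (α.2.1 hkj)]
  · by_cases hkj : k = j
    · subst hkj
      have hml : (m, l) ∈ α.1 := α.2.2 _ _ _ hp hq
      refine ⟨(gen ⟨(m, l), hml, fun e => hkl (congrArg Prod.snd e).symm⟩ (-r * -a))⁻¹, ?_⟩
      rw [map_inv, incl_gen, ← commutator_gen_gen hp hq hml _ _ (α.2.1 hml),
        commutatorElement_inv]
    · exact ⟨1, by rw [map_one, commutator_gen_gen_eq_one hq hp _ _ hkj hlm]⟩

/-- Moving the generators in position p to the left past the others creates no new ones in that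
position (`exists_gen_mul_gen_eq`), so they all merge into a single one. -/
theorem exists_eq_gen_mul_incl {α : ClosedSet n} (p : α.1) (h : α.1 \ {p.1} ⊆ α.1)
    (x : SteinbergOn R α.1) : ∃ r s, x = gen p r * incl h s := by
  induction x using induction_left with
  | one => exact ⟨0, 1, by rw [gen_zero, map_one, one_mul]⟩
  | gen_mul q a x ih =>
    obtain ⟨r, s, rfl⟩ := ih
    by_cases hq : q = p
    · subst hq
      exact ⟨a + r, s, by rw [← mul_assoc, gen_mul_gen]⟩
    · obtain ⟨t, ht⟩ := exists_gen_mul_gen_eq p h ⟨q.1, q.2, fun e => hq (Subtype.ext e)⟩ a r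
      exact ⟨r, t * s, by rw [← mul_assoc, ht, map_mul, mul_assoc]⟩

end SteinbergOn

/-- The matrix agrees with the identity matrix outside of `S`. -/
def IsSupportedOn (S : Set (Fin n × Fin n)) (M : Matrix (Fin n) (Fin n) R) : Prop :=
  ∀ i j, (i, j) ∉ S → M i j = (1 : Matrix (Fin n) (Fin n) R) i j

/-! ### Matrices supported on a closed set. -/

theorem elementary_mul_apply (i j : Fin n) (h : i ≠ j) (r : R)
    (g : Matrix.GeneralLinearGroup (Fin n) R) (k l : Fin n) :
    (elementary i j h r * g).val k l = g.val k l + if k = i then r * g.val j l else 0 := by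
  change ((1 + Matrix.single i j r) * g.val) k l = _
  rw [add_mul, one_mul, Matrix.add_apply]
  split_ifs with e
  · subst e
    rw [Matrix.single_mul_apply_same]
  · rw [Matrix.single_mul_apply_of_ne _ _ _ _ _ e]

/-- The row operation adds r times row j to row i. If (i, l) lies outside α, then closedness puts
(j, l) outside α, and j ≠ l because (i, j) is in α; so the entry of row j that is added to position
(i, l) is 0. -/
theorem IsSupportedOn.elementary_mul {α : ClosedSet n} {g : Matrix.GeneralLinearGroup (Fin n) R}
    (hg : IsSupportedOn α.1 g.val) {i j : Fin n} (h : (i, j) ∈ α.1) (r : R) :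
    IsSupportedOn α.1 (elementary i j (α.ne h) r * g).val := by
  intro k l hkl
  rw [elementary_mul_apply, hg k l hkl]
  split_ifs with e
  · subst e
    have hjl : (j, l) ∉ α.1 := fun hjl => hkl (α.2.2 _ _ _ h hjl)
    have hne : j ≠ l := fun e => hkl (e ▸ h)
    rw [hg j l hjl, Matrix.one_apply_ne hne, mul_zero, add_zero]
  · rw [add_zero]

theorem SteinbergOn.isSupportedOn_eval (α : ClosedSet n) (x : SteinbergOn R α.1) :
    IsSupportedOn α.1 (eval α.1 α.2.1 x).val := by
  induction x using induction_left with
  | one => exact fun i j _ => by rw [map_one, Units.val_one]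
  | gen_mul p r x ih =>
    rw [map_mul, eval_gen]
    exact ih.elementary_mul p.2 r

/-- A non-empty closed set contains a position which is not composed of two others. -/
theorem ClosedSet.exists_indecomposable (α : ClosedSet n) (h : α.1.Nonempty) :
    ∃ p ∈ α.1, ∀ k, (p.1, k) ∈ α.1 → (k, p.2) ∉ α.1 := by
  -- Take p with the fewest intermediate indices. If p = (i, j) were split by k, the intermediates
  -- of (i, k) would be among those of (i, j), with k itself missing since (k, k) is not in α.
  obtain ⟨p, hp, hmin⟩ := (measure fun p : Fin n × Fin n =>
    Set.ncard {k | (p.1, k) ∈ α.1 ∧ (k, p.2) ∈ α.1}).wf.has_min α.1 h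
  refine ⟨p, hp, fun k hk hk' => hmin (p.1, k) hk ?_⟩
  refine Set.ncard_lt_ncard ⟨fun i hi => ⟨hi.1, α.2.2 _ _ _ hi.2 hk'⟩, fun hsub => ?_⟩
    (Set.toFinite _)
  exact α.2.1 (hsub (show k ∈ {k | (p.1, k) ∈ α.1 ∧ (k, p.2) ∈ α.1} from ⟨hk, hk'⟩)).2 rfl

/-- The evaluation homomorphism identifies the Steinberg group of a closed set with the group of
invertible matrices supported on that set. -/
theorem SteinbergOn.eval_injective_and_exists (α : ClosedSet n) :
    Function.Injective (eval (R := R) α.1 α.2.1) ∧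
      ∀ g : Matrix.GeneralLinearGroup (Fin n) R, IsSupportedOn α.1 g.val →
        ∃ x, eval α.1 α.2.1 x = g := by
  induction hN : α.1.ncard using Nat.strong_induction_on generalizing α with
  | _ N ih =>
  rcases Set.eq_empty_or_nonempty α.1 with h0 | h0
  · have key : ∀ x : SteinbergOn R α.1, x = 1 := fun x => by
      induction x using induction_left with
      | one => rfl
      | gen_mul p r x _ => exact (Set.eq_empty_iff_forall_notMem.1 h0 p.1 p.2).elim
    refine ⟨fun x y _ => (key x).trans (key y).symm, fun g hg => ⟨1, ?_⟩⟩
    rw [map_one]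
    refine Units.ext (Matrix.ext fun i j => ?_)
    exact (hg i j (by rw [h0]; exact Set.notMem_empty _)).symm
  obtain ⟨⟨m, j⟩, hp, hcov⟩ := α.exists_indecomposable h0
  have hsub : α.1 \ {(m, j)} ⊆ α.1 := Set.sdiff_subset
  -- Indecomposability of (m, j) is exactly what keeps the complement closed.
  let β : ClosedSet n := ⟨α.1 \ {(m, j)}, hsub.trans α.2.1, fun i k l h1 h2 =>
    ⟨α.2.2 _ _ _ h1.1 h2.1, fun e => by
      obtain ⟨rfl, rfl⟩ := Prod.mk.inj e
      exact hcov k h1.1 h2.1⟩⟩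
  have hlt : β.1.ncard < N := hN ▸ Set.ncard_sdiff_singleton_lt_of_mem hp
  obtain ⟨hinj, hsurj⟩ := ih _ hlt β rfl
  have hmj : m ≠ j := α.2.1 hp
  constructor
  · rw [injective_iff_map_eq_one]
    intro x hx
    obtain ⟨r, s, rfl⟩ := exists_eq_gen_mul_incl ⟨(m, j), hp⟩ hsub x
    have hs : IsSupportedOn β.1 (eval β.1 β.2.1 s).val := isSupportedOn_eval β s
    rw [map_mul, eval_gen, eval_incl] at hx
    -- The factor from β has entry 1 at (j, j) and 0 at (m, j), so the (m, j) entry of the product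
    -- is r. It must vanish, which leaves the factor from β to the induction hypothesis.
    have hr := congrArg (fun g : Matrix.GeneralLinearGroup (Fin n) R => g.val m j) hx
    have hjj : (eval β.1 β.2.1 s).val j j = 1 := by
      rw [hs j j fun h => β.2.1 h rfl, Matrix.one_apply_eq]
    have hmj0 : (eval β.1 β.2.1 s).val m j = 0 := by
      rw [hs m j fun h => h.2 rfl, Matrix.one_apply_ne hmj]
    change (elementary m j hmj r * eval β.1 β.2.1 s).val m j = _ at hr
    rw [elementary_mul_apply, if_pos rfl, hjj, hmj0, mul_one, zero_add, Units.val_one,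
      Matrix.one_apply_ne hmj] at hr
    subst hr
    rw [← eval_gen α.2.1 ⟨(m, j), hp⟩, gen_zero, map_one, one_mul] at hx
    have hs1 : s = 1 := hinj (hx.trans (map_one _).symm)
    rw [hs1, gen_zero, map_one, one_mul]
  · intro g hg
    have hjj : g.val j j = 1 := by rw [hg j j fun h => α.2.1 h rfl, Matrix.one_apply_eq]
    have hg' := hg.elementary_mul hp (-g.val m j)
    -- Since the (j, j) entry of g is 1, subtracting g_mj times row j from row m clears the entry at
    -- (m, j) and leaves a matrix supported on β.
    obtain ⟨y, hy⟩ := hsurj (elementary m j hmj (-g.val m j) * g) (fun k l hkl => by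
      by_cases e : (k, l) = (m, j)
      · obtain ⟨rfl, rfl⟩ := Prod.mk.inj e
        rw [elementary_mul_apply, if_pos rfl, hjj, mul_one, add_neg_cancel,
          Matrix.one_apply_ne hmj]
      · exact hg' k l fun h => hkl ⟨h, e⟩)
    refine ⟨gen ⟨(m, j), hp⟩ (g.val m j) * incl hsub y, ?_⟩
    rw [map_mul, eval_incl]
    change _ * eval β.1 β.2.1 y = g
    rw [hy, eval_gen, ← mul_assoc, _root_.elementary_mul, add_neg_cancel,
      ← eval_gen α.2.1 ⟨(m, j), hp⟩, gen_zero, map_one, one_mul]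

theorem SteinbergOn.eval_injective (α : ClosedSet n) :
    Function.Injective (eval (R := R) α.1 α.2.1) :=
  (eval_injective_and_exists α).1

theorem SteinbergOn.range_eval (S : Set (Fin n × Fin n)) (hS : S ⊆ offDiagonal n) :
    (eval (R := R) S hS).range = elementarySubgroup R S := by
  refine le_antisymm ?_ ((Subgroup.closure_le _).2 ?_)
  · rintro _ ⟨x, rfl⟩
    induction x using induction_left with
    | one => rw [map_one]; exact one_mem _
    | gen_mul p r x ih =>
      rw [map_mul, eval_gen]
      exact mul_mem (Subgroup.subset_closure ⟨_, _, hS p.2, r, p.2, rfl⟩) ih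
  · rintro _ ⟨i, j, h, r, hij, rfl⟩
    exact ⟨gen ⟨(i, j), hij⟩ r, eval_gen hS _ _⟩

/-- Elements of Steinberg groups of two closed sets with the same evaluation have the same image
in the Steinberg group. -/
theorem SteinbergOn.incl_eq_incl_of_eval_eq {α β : ClosedSet n} {x : SteinbergOn R α.1}
    {y : SteinbergOn R β.1} (h : eval α.1 α.2.1 x = eval β.1 β.2.1 y) :
    (incl α.2.1 x : Steinberg n R) = incl β.2.1 y := by
  let γ : ClosedSet n := ⟨α.1 ∩ β.1, Set.inter_subset_left.trans α.2.1, fun i j k h1 h2 =>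
    ⟨α.2.2 _ _ _ h1.1 h2.1, β.2.2 _ _ _ h1.2 h2.2⟩⟩
  have hα : γ.1 ⊆ α.1 := Set.inter_subset_left
  have hβ : γ.1 ⊆ β.1 := Set.inter_subset_right
  -- The common matrix is supported on α and on β, hence on the intersection, so it has a preimage z
  -- there. Injectivity over α and over β shows that both x and y come from z.
  obtain ⟨z, hz⟩ := (eval_injective_and_exists (R := R) γ).2 (eval α.1 α.2.1 x) (fun i j hij => by
    by_cases hi : (i, j) ∈ α.1
    · rw [h]
      exact isSupportedOn_eval β y i j fun hj => hij ⟨hi, hj⟩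
    · exact isSupportedOn_eval α x i j hi)
  have e1 : incl hα z = x := eval_injective α (by rw [eval_incl, hz])
  have e2 : incl hβ z = y := eval_injective β (by rw [eval_incl, hz, h])
  rw [← e1, ← e2, incl_incl, incl_incl]

/-- The Steinberg group is the colimit of the Steinberg groups of closed sets. -/
theorem Steinberg.exists_hom {M : Type*} [Group M] (ρ : ∀ α : ClosedSet n, SteinbergOn R α.1 →* M)
    (hρ : ∀ {α β : ClosedSet n} (h : α ≤ β) (x : SteinbergOn R α.1),
      ρ β (SteinbergOn.incl h x) = ρ α x) :
    ∃ f : Steinberg n R →* M, ∀ (α : ClosedSet n) (x : SteinbergOn R α.1),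
      f (SteinbergOn.incl α.2.1 x) = ρ α x := by
  let single (p : offDiagonal n) : ClosedSet n := ⟨{p.1}, Set.singleton_subset_iff.2 p.2, by
    intro i j k h1 h2
    have e1 : i ≠ j := by
      have := p.2
      rw [← Set.mem_singleton_iff.1 h1] at this
      exact this
    have := Set.mem_singleton_iff.1 (h1.trans (Set.mem_singleton_iff.1 h2).symm)
    exact absurd (congrArg Prod.fst this) e1⟩
  -- A single position is a closed set, which forces the image of each generator. By compatibility
  -- any larger closed set containing the position gives the same image, so each relation can be
  -- checked inside one suitable closed set.
  let F : offDiagonal n × R → M := fun x => ρ (single x.1) (SteinbergOn.gen ⟨x.1.1, rfl⟩ x.2)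
  have hF : ∀ (α : ClosedSet n) (p : offDiagonal n) (hp : p.1 ∈ α.1) (r : R),
      F (p, r) = ρ α (SteinbergOn.gen ⟨p.1, hp⟩ r) := fun α p hp r => by
    have hle : single p ≤ α := Set.singleton_subset_iff.2 hp
    change ρ _ _ = _
    rw [← hρ hle, SteinbergOn.incl_gen]
  have hrel : ∀ w ∈ {w : FreeGroup (offDiagonal n × R) | SteinbergRel (offDiagonal n) w},
      FreeGroup.lift F w = 1 := by
    intro w hw
    cases hw with
    | additive p a b =>
      simp only [map_mul, map_inv, FreeGroup.lift_apply_of]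
      refine mul_inv_eq_one.2 ?_
      change ρ (single p) _ * ρ (single p) _ = ρ (single p) _
      rw [← map_mul, SteinbergOn.gen_mul_gen]
    | commute i j k l h h' a b hil hjk =>
      simp only [map_commutatorElement, FreeGroup.lift_apply_of]
      have hij : i ≠ j := h
      have hkl : k ≠ l := h'
      -- No two of these positions compose, because i ≠ l and j ≠ k.
      let α : ClosedSet n := ⟨{(i, j), (k, l)}, by
        rintro _ (rfl | rfl)
        exacts [h, h'], by
        rintro x y z h1 h2
        simp only [Set.mem_insert_iff, Set.mem_singleton_iff, Prod.mk.injEq] at h1 h2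
        grind⟩
      have h1 : (i, j) ∈ α.1 := Or.inl rfl
      have h2 : (k, l) ∈ α.1 := Or.inr rfl
      rw [hF α _ h1, hF α _ h2, ← map_commutatorElement,
        SteinbergOn.commutator_gen_gen_eq_one h1 h2 _ _ hil hjk, map_one]
    | commutator i j l h h' h'' a b hil =>
      simp only [map_mul, map_inv, map_commutatorElement, FreeGroup.lift_apply_of]
      refine mul_inv_eq_one.2 ?_
      have hij : i ≠ j := h
      have hjl : j ≠ l := h'
      -- The only composable pair is (i, j), (j, l), and its composite (i, l) is included.
      let α : ClosedSet n := ⟨{(i, j), (j, l), (i, l)}, by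
        rintro _ (rfl | rfl | rfl)
        exacts [h, h', h''], by
        rintro x y z h1 h2
        simp only [Set.mem_insert_iff, Set.mem_singleton_iff, Prod.mk.injEq] at h1 h2 ⊢
        grind⟩
      have h1 : (i, j) ∈ α.1 := Or.inl rfl
      have h2 : (j, l) ∈ α.1 := Or.inr (Or.inl rfl)
      have h3 : (i, l) ∈ α.1 := Or.inr (Or.inr rfl)
      rw [hF α _ h1, hF α _ h2, hF α _ h3, ← map_commutatorElement,
        SteinbergOn.commutator_gen_gen h1 h2 h3 _ _ hil]
  refine ⟨PresentedGroup.toGroup (f := F) hrel, fun α x => ?_⟩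
  have : (PresentedGroup.toGroup (f := F) hrel).comp (SteinbergOn.incl α.2.1) = ρ α := by
    refine SteinbergOn.hom_ext fun p r => ?_
    rw [MonoidHom.comp_apply, SteinbergOn.incl_gen, SteinbergOn.gen, PresentedGroup.toGroup.of]
    exact hF α ⟨p.1, α.2.1 p.2⟩ p.2 r
  exact DFunLike.congr_fun this x

/-- The Steinberg group is generated by the images of the Steinberg groups of closed sets. -/
theorem Steinberg.induction_left {P : Steinberg n R → Prop} (one : P 1)
    (incl_mul : ∀ (α : ClosedSet n) (s : SteinbergOn R α.1) x, P x →
      P (SteinbergOn.incl α.2.1 s * x)) (x : Steinberg n R) : P x := by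
  induction x using SteinbergOn.induction_left with
  | one => exact one
  | gen_mul p r x ih =>
    obtain ⟨⟨i, j⟩, hp⟩ := p
    have hij : i ≠ j := hp
    let α : ClosedSet n := ⟨{(i, j)}, Set.singleton_subset_iff.2 hp, by
      intro x y z h1 h2
      simp only [Set.mem_singleton_iff, Prod.mk.injEq] at h1 h2
      grind⟩
    have := incl_mul α (SteinbergOn.gen ⟨(i, j), rfl⟩ r) x ih
    rwa [SteinbergOn.incl_gen] at this

end LinearGroups

namespace GlobalAction

section Covering

variable {A : GlobalAction.{u, v, w}} {B : GlobalAction.{u₁, u₂, u₃}} {q : B → A}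

/-! ### Lifting along coverings -/

theorem IsLocal.self_of_subset {s : Set A} (hs : A.IsLocal s) {a : A} (ha : a ∈ s) :
    A.IsLocal {a, a} :=
  hs.mono (by rintro _ (rfl | rfl) <;> exact ha)

theorem IsLocal.exists_smul_eq {x y : A} (h : A.IsLocal {x, y}) :
    ∃ (α : A.Coord) (hx : x ∈ A.dom α) (σ : A.Grp α),
      ((σ • (⟨x, hx⟩ : A.dom α) : A.dom α) : A) = y := by
  obtain ⟨α, z, hz⟩ := h
  obtain ⟨g, rfl⟩ := hz x (Or.inl rfl)
  obtain ⟨k, rfl⟩ := hz y (Or.inr rfl)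
  refine ⟨α, (g • z).2, k * g⁻¹, ?_⟩
  rw [Subtype.coe_eta, smul_smul, inv_mul_cancel_right]

theorem Path.link_toFun_of_nonpos {x y : A} (h : A.IsLocal {x, y}) (n : ℤ) (hn : n ≤ 0) :
    (Path.link x y h).toFun n = x := if_pos hn

theorem IsCovering.exists_lift_frame (hq : IsCovering B A q) {p : ℕ} {x : Fin (p + 1) → A}
    (hx : A.IsLocal (Set.range x)) {y : B} (hy : q y = x 0) :
    ∃ z : Fin (p + 1) → B, B.IsLocal (Set.range z) ∧ z 0 = y ∧ ∀ i, q (z i) = x i := by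
  obtain ⟨z, ⟨hz, h0, h1⟩, -⟩ := hq.2 p x ((isLocalFrame_iff A x).2 hx) y hy
  exact ⟨z, (isLocalFrame_iff B z).1 hz, h0, h1⟩

theorem IsCovering.exists_lift (hq : IsCovering B A q) {x : A} {y : B}
    (h : A.IsLocal {q y, x}) : ∃ z, B.IsLocal {y, z} ∧ q z = x := by
  obtain ⟨z, hz, rfl, h1⟩ := hq.exists_lift_frame (p := 1) (x := ![q y, x]) (y := y)
    (h.mono (by rintro _ ⟨i, rfl⟩; fin_cases i <;> simp)) rfl
  exact ⟨z 1, hz.mono (by rintro _ (rfl | rfl) <;> exact ⟨_, rfl⟩), h1 1⟩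

theorem IsCovering.lift_unique (hq : IsCovering B A q) {y z z' : B} (h : B.IsLocal {y, z})
    (h' : B.IsLocal {y, z'}) (hz : q z = q z') : z = z' := by
  have key : ∀ t, B.IsLocal {y, t} → B.IsLocalFrame (p := 1) ![y, t] := fun t ht =>
    (isLocalFrame_iff B _).2 (ht.mono (by rintro _ ⟨i, rfl⟩; fin_cases i <;> simp))
  have hf := hq.1 1 _ (key z h)
  have := (hq.2 1 _ hf y rfl).unique (y₁ := ![y, z]) (y₂ := ![y, z'])
    ⟨key z h, rfl, fun _ => rfl⟩ ⟨key z' h', rfl, fun i => by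
      fin_cases i
      · rfl
      · exact hz.symm⟩
  exact congrFun this 1

/-- Two adjacent steps in a covering are adjacent if their images are. -/
theorem IsCovering.isLocal_of_square (hq : IsCovering B A q) {y y' z z' : B}
    (hy : B.IsLocal {y, y'}) (h : B.IsLocal {y, z}) (h' : B.IsLocal {y', z'})
    (hA : A.IsLocal {q y, q z, q y', q z'}) : B.IsLocal {z, z'} := by
  -- The whole square is lifted as one frame starting at y. Uniqueness along edges identifies its
  -- members with z and y' first, and then with z' by way of y'; so z and z' lie in one frame.
  obtain ⟨t, ht, rfl, h1⟩ := hq.exists_lift_frame (p := 3) (x := ![q y, q z, q y', q z']) (y := y)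
    (hA.mono (by rintro _ ⟨i, rfl⟩; fin_cases i <;> simp)) rfl
  have key : ∀ i j, B.IsLocal {t i, t j} := fun i j =>
    ht.mono (by rintro _ (rfl | rfl) <;> exact ⟨_, rfl⟩)
  obtain rfl : t 1 = z := hq.lift_unique (key 0 1) h (h1 1)
  obtain rfl : t 2 = y' := hq.lift_unique (key 0 2) hy (h1 2)
  obtain rfl : t 3 = z' := hq.lift_unique (key 2 3) h' (h1 3)
  exact key 1 3

/-- The path is lifted one step at a time from a position N before which it is constant. Stage k
lifts the path that follows f up to k and then stays put; by stage M the path f has stabilised. -/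
theorem IsCovering.exists_path_lift (hq : IsCovering B A q) {a b : A} (f : A.Path a b) {y : B}
    (hy : q y = a) : ∃ z, q z = b ∧ ∃ g : B.Path y z, ∀ n, q (g.toFun n) = f.toFun n := by
  subst hy
  obtain ⟨N, M, hNM, hN, hM⟩ := f.stabilises
  have key : ∀ k ≥ N, ∃ z, ∃ g : B.Path y z, (∀ n ≥ k, g.toFun n = z) ∧
      ∀ n, q (g.toFun n) = f.toFun (min n k) := by
    intro k hk
    induction k, hk using Int.leInduction with
    | base =>
      -- Points of B need not lie in a local set, so the constant path at y needs an argument: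
      -- lifting the step of f at N puts y in a local orbit.
      have h0 : A.IsLocal {q y, f.toFun (N + 1)} := by
        have := f.isLocal N
        rwa [hN N le_rfl] at this
      obtain ⟨z, hz, -⟩ := hq.exists_lift h0
      have hyy := hz.self_of_subset (Or.inl rfl)
      refine ⟨y, Path.mk₂ (fun _ => y) (fun _ => hyy) ⟨0, fun _ _ => rfl⟩ ⟨0, fun _ _ => rfl⟩,
        fun _ _ => rfl, fun n => ?_⟩
      exact (hN _ (min_le_right _ _)).symm
    | succ k hk ih =>
      obtain ⟨z, g, hg, hgf⟩ := ih
      have hz : q z = f.toFun k := by rw [← hg k le_rfl, hgf, min_self]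
      obtain ⟨z', hz', hqz'⟩ := hq.exists_lift (x := f.toFun (k + 1)) (y := z)
        (by rw [hz]; exact f.isLocal k)
      refine ⟨z', g.concat (Path.link z z' hz') k 0 hg (Path.link_toFun_of_nonpos _), fun n hn => ?_,
        fun n => ?_⟩
      · rw [Path.concat_toFun, if_neg (by omega), Path.link_toFun, if_neg (by omega)]
      · rw [Path.concat_toFun]
        split_ifs with hn
        · rw [hgf, min_eq_left hn, min_eq_left (by omega)]
        · rw [Path.link_toFun, if_neg (by omega), hqz', min_eq_right (by omega)]
  obtain ⟨z, g, hg, hgf⟩ := key M hNM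
  refine ⟨z, ?_, g, fun n => ?_⟩
  · rw [← hg M le_rfl, hgf, min_self, hM M le_rfl]
  · rw [hgf]
    rcases le_total n M with h | h
    · rw [min_eq_left h]
    · rw [min_eq_right h, hM M le_rfl, hM n h]

/-- Far to the left both lifts are at y, and `isLocal_of_square` carries adjacency of the two lifts
one step to the right. Far to the right z and z' are then adjacent and lie over the same point, so
they coincide. -/
theorem IsCovering.end_eq_of_adjacent (hq : IsCovering B A q) {y z z' : B} (g : B.Path y z)
    (g' : B.Path y z') (hz : q z = q z')
    (h : ∀ m, A.IsLocal {q (g.toFun m), q (g.toFun (m + 1)), q (g'.toFun m),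
      q (g'.toFun (m + 1))}) : z = z' := by
  obtain ⟨N, hN⟩ := g.exists_left
  obtain ⟨N', hN'⟩ := g'.exists_left
  obtain ⟨M, hM⟩ := g.exists_right
  obtain ⟨M', hM'⟩ := g'.exists_right
  have key : ∀ k ≥ min N N', B.IsLocal {g.toFun k, g'.toFun k} := by
    intro k hk
    induction k, hk using Int.leInduction with
    | base =>
      have := (g.isLocal (min N N')).self_of_subset (Or.inl rfl)
      rwa [(hN' _ (min_le_right _ _)).trans (hN (min N N') (min_le_left _ _)).symm]
    | succ k _ ih => exact hq.isLocal_of_square ih (g.isLocal k) (g'.isLocal k) (h k)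
  have hloc := key (max (min N N') (max M M')) (le_max_left _ _)
  rw [hM _ (by omega), hM' _ (by omega)] at hloc
  exact hq.lift_unique (hloc.self_of_subset (Or.inl rfl)) hloc hz

/-- Lifts of homotopic paths have the same end point. -/
theorem IsCovering.end_eq_of_homotopic (hq : IsCovering B A q) {a b : A} {f f' : A.Path a b}
    (H : Homotopic f f') {y z z' : B} (g : B.Path y z) (g' : B.Path y z')
    (hg : ∀ n, q (g.toFun n) = f.toFun n) (hg' : ∀ n, q (g'.toFun n) = f'.toFun n) : z = z' := by
  obtain ⟨h, H⟩ := H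
  obtain ⟨N, M, hNM, h₁, h₂, h₃, h₄⟩ := H.stabilises
  let row (n : ℤ) : A.Path a b := Path.mk₂ (fun m => h (m, n))
    (fun m => (H.isLocal m n).mono (by rintro _ (rfl | rfl) <;> simp))
    ⟨N, fun m hm => h₃ m hm n⟩ ⟨M, fun m hm => h₄ m hm n⟩
  have end_eq : ∀ {f : A.Path a b} {y z : B} (g : B.Path y z),
      (∀ n, q (g.toFun n) = f.toFun n) → q z = b ∧ q y = a := by
    intro f y z g hg
    obtain ⟨K, hK⟩ := g.exists_right
    obtain ⟨K', hK'⟩ := f.exists_right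
    obtain ⟨L, hL⟩ := g.exists_left
    obtain ⟨L', hL'⟩ := f.exists_left
    constructor
    · rw [← hK (max K K') (le_max_left _ _), hg, hK' _ (le_max_right _ _)]
    · rw [← hL (min L L') (min_le_left _ _), hg, hL' _ (min_le_right _ _)]
  -- The rows of the homotopy are paths from a to b, the row at N being f and the row at M being f'.
  -- By induction every lift from y of any row ends at z: consecutive rows bound squares lying in
  -- local orbits, so `end_eq_of_adjacent` applies to their lifts.
  have key : ∀ n ≥ N, ∀ z' (g' : B.Path y z'), (∀ m, q (g'.toFun m) = h (m, n)) → z = z' := by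
    intro n hn
    induction n, hn using Int.leInduction with
    | base =>
      intro z' g' hg'
      refine hq.end_eq_of_adjacent g g' ?_ fun m => ?_
      · rw [(end_eq g hg).1, (end_eq (f := row N) g' hg').1]
      · rw [hg, hg, hg', hg', h₁ N le_rfl, h₁ N le_rfl]
        exact f.isLocal_square m (Or.inl rfl) (Or.inr rfl) (Or.inl rfl) (Or.inr rfl)
    | succ n _ ih =>
      intro z' g' hg'
      obtain ⟨z'', -, g'', hg''⟩ := hq.exists_path_lift (row n) (end_eq g hg).2
      rw [ih z'' g'' hg'']
      refine hq.end_eq_of_adjacent g'' g' ?_ fun m => ?_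
      · rw [(end_eq g'' hg'').1, (end_eq (f := row (n + 1)) g' hg').1]
      · rw [hg'', hg'', hg', hg']
        exact H.isLocal m n
  exact key M hNM z' g' fun m => (hg' m).trans (h₂ M le_rfl m).symm

end Covering

/-! ### Induction along based paths -/

/-- A path is recovered from its truncations at k, constant after k; each truncation is the
preceding one followed by a link. -/
theorem PathClass.sigma_induction {A : GlobalAction.{u, v, w}} {a : A}
    {P : (Σ b : A, A.PathClass a b) → Prop} (const : ∀ h, P ⟨a, PathClass.const a h⟩)
    (comp_link : ∀ b c (x : A.PathClass a b) (h : A.IsLocal {b, c}),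
      P ⟨b, x⟩ → P ⟨c, x.comp (PathClass.link b c h)⟩) (u : Σ b : A, A.PathClass a b) : P u := by
  obtain ⟨b, x⟩ := u
  obtain ⟨f, rfl⟩ := PathClass.mk_surjective x
  obtain ⟨N, M, hNM, hN, hM⟩ := f.stabilises
  -- The end point is a variable c with an equation, so that at the last stage b can be substituted
  -- without transporting path classes.
  have key : ∀ k ≥ N, ∀ c, f.toFun k = c → ∃ t : A.Path a c, (∀ n, t.toFun n = f.toFun (min n k)) ∧
      P ⟨c, PathClass.mk t⟩ := by
    intro k hk
    induction k, hk using Int.leInduction with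
    | base =>
      rintro c rfl
      rw [hN N le_rfl]
      -- No covering hypothesis is made on A; the step of f at N shows that a lies in a local set.
      have hdom : ∃ α, a ∈ A.dom α := by
        have := (f.isLocal N).exists_smul_eq
        rw [hN N le_rfl] at this
        exact ⟨this.choose, this.choose_spec.choose⟩
      exact ⟨Path.const a hdom, fun n => (hN _ (min_le_right _ _)).symm, const hdom⟩
    | succ k _ ih =>
      rintro c rfl
      obtain ⟨t, ht, hP⟩ := ih _ rfl
      have ht' : ∀ n ≥ k, t.toFun n = f.toFun k := fun n hn => by rw [ht, min_eq_right hn]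
      refine ⟨t.concat (Path.link _ _ (f.isLocal k)) k 0 ht' (Path.link_toFun_of_nonpos _), fun n => ?_,
        ?_⟩
      · rw [Path.concat_toFun]
        split_ifs with hn
        · rw [ht, min_eq_left hn, min_eq_left (by omega)]
        · rw [Path.link_toFun, if_neg (by omega), min_eq_right (by omega)]
      · rw [← PathClass.mk_comp_mk]
        exact comp_link _ _ _ _ hP
  obtain ⟨t, ht, hP⟩ := key M hNM b (hM M le_rfl)
  have : t = f := Path.ext fun n => by
    rw [ht]
    rcases le_total n M with h | h
    · rw [min_eq_left h]
    · rw [min_eq_right h, hM M le_rfl, hM n h]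
  rwa [this] at hP

/-! ### Global actions with a single domain -/

section SingleDomain

variable {A : GlobalAction.{u, v, w}} (hA : ∀ (α : A.Coord) (x : A), x ∈ A.dom α)

/-- In a global action in which every local set is the whole underlying set, the local groups act
by permutations of the underlying set. -/
def permHom (α : A.Coord) : A.Grp α →* Equiv.Perm A :=
  letI : MulAction (A.Grp α) A :=
    { smul := fun σ x => ((σ • (⟨x, hA α x⟩ : A.dom α) : A.dom α) : A)
      one_smul := fun x => congrArg Subtype.val (one_smul (A.Grp α) (⟨x, hA α x⟩ : A.dom α))
      mul_smul := fun σ τ x => congrArg Subtype.val (mul_smul σ τ (⟨x, hA α x⟩ : A.dom α)) }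
  MulAction.toPermHom (A.Grp α) A

theorem permHom_map {α β : A.Coord} (h : A.le α β) (σ : A.Grp α) :
    permHom hA β (A.map h σ) = permHom hA α σ :=
  Equiv.ext fun x => (A.smul_eq h σ x (hA α x) (hA β x)).symm

theorem isLocal_permHom {α : A.Coord} (σ : A.Grp α) (x : A) :
    A.IsLocal {x, permHom hA α σ x} :=
  isLocal_smul α σ ⟨x, hA α x⟩

/-- Every link has the form x, σx with σ in a local group, so appending links is acting by local
groups, and these actions reach everything from the base point. -/
theorem universalCovering_induction [A.IsCovered] {a : A} {P : A.universalCovering a → Prop}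
    (base : P (A.universalCoveringBase a))
    (smul : ∀ α σ u, P u →
      P (permHom (A := A.universalCovering a) (fun α x => hA α x.1) α σ u))
    (u : A.universalCovering a) : P u := by
  refine PathClass.sigma_induction (P := P) (fun _ => base) (fun b c x h hP => ?_) u
  obtain ⟨α, hb, σ, rfl⟩ := h.exists_smul_eq
  exact smul α σ ⟨b, x⟩ hP

/-- The local groups of a single domain global action act on its coverings. -/
theorem IsCovering.exists_permHom {B : GlobalAction.{u₁, u₂, u₃}} {q : B → A}
    (hq : IsCovering B A q) : ∃ ρ : ∀ α, A.Grp α →* Equiv.Perm B, ∀ α σ y,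
      B.IsLocal {y, ρ α σ y} ∧ q (ρ α σ y) = permHom hA α σ (q y) := by
  -- Here ℓ α σ y is the end of the lift from y of the step from q y to σ (q y).
  choose ℓ hℓ hqℓ using fun (α : A.Coord) (σ : A.Grp α) (y : B) =>
    hq.exists_lift (isLocal_permHom hA σ (q y))
  let act (α : A.Coord) : MulAction (A.Grp α) B :=
    { smul := ℓ α
      one_smul := fun y => hq.lift_unique (hℓ α 1 y) ((hℓ α 1 y).self_of_subset (Or.inl rfl))
        (by
          change q (ℓ α 1 y) = q y
          rw [hqℓ, map_one, Equiv.Perm.one_apply])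
      mul_smul := fun τ σ y => by
        have hq' : q (ℓ α (τ * σ) y) = q (ℓ α τ (ℓ α σ y)) := by
          rw [hqℓ, hqℓ, hqℓ, map_mul, Equiv.Perm.mul_apply]
        -- The points q y, σ (q y) and τσ (q y) lie in one local orbit, so the two candidates for τσ
        -- y are adjacent; lying over the same point, they are equal.
        have := hq.isLocal_of_square (hℓ α σ y) (hℓ α (τ * σ) y) (hℓ α τ (ℓ α σ y)) (by
          rw [← hq', hqℓ, hqℓ, map_mul, Equiv.Perm.mul_apply]
          refine (isLocal_smul_smul α σ τ ⟨q y, hA α _⟩).mono ?_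
          rintro _ (rfl | rfl | rfl | rfl)
          exacts [Or.inl rfl, Or.inr (Or.inr rfl), Or.inr (Or.inl rfl), Or.inr (Or.inr rfl)])
        exact (hq.lift_unique this (this.self_of_subset (Or.inl rfl)) hq'.symm).symm }
  exact ⟨fun α => letI := act α; MulAction.toPermHom (A.Grp α) B,
    fun α σ y => ⟨hℓ α σ y, hqℓ α σ y⟩⟩

end SingleDomain

/-! ### Coverings of translation actions -/

section Translation

variable {G G' : Type*} [Group G] [Group G'] {Φ : Type*} [Preorder Φ] {H H' : Φ → Type*}
  [∀ α, Group (H α)] [∀ α, Group (H' α)] {ι : ∀ α, H α →* G} {ι' : ∀ α, H' α →* G'}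
  {map : ∀ {α β : Φ}, α ≤ β → (H α →* H β)} {map' : ∀ {α β : Φ}, α ≤ β → (H' α →* H' β)}

/-- Surjectivity of the ψ α gives lifts of frames. The hypothesis `hinj` compares two coordinates
because a competing lift may be a frame for a different local group. -/
theorem isCovering_translationAction
    (ι_map : ∀ {α β : Φ} (h : α ≤ β) (σ : H α), ι β (map h σ) = ι α σ)
    (ι_map' : ∀ {α β : Φ} (h : α ≤ β) (σ : H' α), ι' β (map' h σ) = ι' α σ) (φ : G →* G') (ψ : ∀ α, H α →* H' α)
    (hφ : ∀ α σ, φ (ι α σ) = ι' α (ψ α σ)) (hψ : ∀ α, Function.Surjective (ψ α))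
    (hinj : ∀ α β (σ : H α) (τ : H β), φ (ι α σ) = φ (ι β τ) → ι α σ = ι β τ) :
    IsCovering (translationAction G Φ H ι map ι_map) (translationAction G' Φ H' ι' map' ι_map') φ := by
  constructor
  · rintro p x ⟨α, _, hx⟩
    refine ⟨α, trivial, fun i => ?_⟩
    obtain ⟨σ, hσ⟩ := hx i
    refine ⟨ψ α σ, ?_⟩
    change ι' α (ψ α σ) * φ (x 0) = φ (x i)
    rw [← hφ, ← map_mul]
    exact congrArg φ hσ
  · rintro p x ⟨α, _, hx⟩ y₀ hy₀
    have hx' : ∀ i, ∃ σ : H α, φ (ι α σ * y₀) = x i := fun i => by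
      obtain ⟨τ, hτ⟩ := hx i
      obtain ⟨σ, rfl⟩ := hψ α τ
      refine ⟨σ, ?_⟩
      rw [map_mul, hφ, hy₀]
      exact hτ
    choose σ hσ using hx'
    -- The chosen σ 0 need not be 1, but its image fixes φ y₀ and is therefore trivial; `hinj`
    -- against 1 makes σ 0 act trivially upstairs.
    have h1 : ι α (σ 0) * y₀ = y₀ := by
      have : φ (ι α (σ 0)) = φ (ι α 1) := by
        rw [map_one, map_one, ← mul_eq_right (b := φ y₀), ← map_mul, hσ 0, hy₀]
      rw [hinj _ _ _ _ this, map_one, one_mul]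
    refine ⟨fun i => ι α (σ i) * y₀, ⟨⟨α, trivial, fun i => ⟨σ i, ?_⟩⟩, h1, hσ⟩, ?_⟩
    · change ι α (σ i) * (ι α (σ 0) * y₀) = _
      rw [h1]
    · rintro y ⟨⟨β, _, hy⟩, rfl, hyx⟩
      funext i
      obtain ⟨τ, hτ⟩ := hy i
      change ι β τ * y 0 = y i at hτ
      rw [← hτ]
      have := (hyx i).trans (hσ i).symm
      rw [← hτ, map_mul, map_mul, mul_left_inj] at this
      rw [hinj _ _ _ _ this]

end Translation

end GlobalAction

section SteinbergCovering

open GlobalAction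

variable (n : ℕ) (R : Type u) [Ring R]

/-! ### The Steinberg covering -/

variable {n} in
/-- Evaluation as a homomorphism between the local groups of the Steinberg and the general linear
global actions. -/
def localEval (α : ClosedSet n) : SteinbergOn R α.1 →* elementarySubgroup R α.1 :=
  (SteinbergOn.eval α.1 α.2.1).codRestrict _
    fun x => SteinbergOn.range_eval (R := R) α.1 α.2.1 ▸ ⟨x, rfl⟩

variable {n} in
theorem localEval_bijective (α : ClosedSet n) : Function.Bijective (localEval R α) := by
  refine ⟨fun x y h => SteinbergOn.eval_injective α (congrArg Subtype.val h), fun y => ?_⟩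
  obtain ⟨x, hx⟩ := (SteinbergOn.range_eval (R := R) α.1 α.2.1).ge y.2
  exact ⟨x, Subtype.ext hx⟩

variable {n R} in
theorem localEval_incl {α β : ClosedSet n} (h : α ≤ β) (x : SteinbergOn R α.1) :
    localEval R β (SteinbergOn.incl h x)
      = Subgroup.inclusion (elementarySubgroup_mono h) (localEval R α x) :=
  Subtype.ext (SteinbergOn.eval_incl h β.2.1 x)

variable {n R} in
theorem steinbergEval_incl {α : ClosedSet n} (x : SteinbergOn R α.1) :
    steinbergEval n R (SteinbergOn.incl α.2.1 x) = (localEval R α x).1 :=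
  SteinbergOn.eval_incl α.2.1 subset_rfl x

theorem steinbergEval_range : (steinbergEval n R).range = elementaryGroup n R :=
  SteinbergOn.range_eval _ _

theorem incl_eq_incl_of_steinbergEval_eq (α β : ClosedSet n) (x : SteinbergOn R α.1)
    (y : SteinbergOn R β.1) (h : steinbergEval n R (SteinbergOn.incl α.2.1 x)
      = steinbergEval n R (SteinbergOn.incl β.2.1 y)) :
    (SteinbergOn.incl α.2.1 x : Steinberg n R) = SteinbergOn.incl β.2.1 y :=
  SteinbergOn.incl_eq_incl_of_eval_eq (by rwa [steinbergEval_incl, steinbergEval_incl] at h)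

theorem isCovering_steinbergEval :
    IsCovering (steinbergAction n R) (generalLinearAction n R) (steinbergEval n R) :=
  isCovering_translationAction (fun _ => SteinbergOn.incl_incl _ _) (fun _ _ => rfl) (steinbergEval n R) (localEval R) (fun _ x => steinbergEval_incl x)
    (fun α => (localEval_bijective R α).2) (incl_eq_incl_of_steinbergEval_eq n R)

theorem isCovering_steinbergToElementary :
    IsCovering (steinbergAction n R) (elementaryAction n R) (steinbergToElementary n R) :=
  isCovering_translationAction (fun _ => SteinbergOn.incl_incl _ _) (fun _ _ => rfl)
    (steinbergToElementary n R) (localEval R)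
    (fun _ x => Subtype.ext (steinbergEval_incl x)) (fun α => (localEval_bijective R α).2)
    fun α β x y h => incl_eq_incl_of_steinbergEval_eq n R α β x y (congrArg Subtype.val h)

theorem steinbergToElementary_surjective : Function.Surjective (steinbergToElementary n R) := by
  rintro ⟨g, hg⟩
  rw [← steinbergEval_range] at hg
  obtain ⟨x, hx⟩ := hg
  exact ⟨x, Subtype.ext hx⟩

/-! ### Simple connectivity of the Steinberg global action -/

theorem steinbergAction_mem_dom (α : (steinbergAction n R).Coord) (x : steinbergAction n R) :
    x ∈ (steinbergAction n R).dom α := trivial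

theorem generalLinearAction_mem_dom (α : (generalLinearAction n R).Coord)
    (x : generalLinearAction n R) : x ∈ (generalLinearAction n R).dom α := trivial

/-- The action of the local groups of the Steinberg global action on its universal covering. -/
noncomputable abbrev steinbergCoverPerm (a : steinbergAction n R) (α : ClosedSet n) :
    SteinbergOn R α.1 →* Equiv.Perm ((steinbergAction n R).universalCovering a) :=
  permHom (A := (steinbergAction n R).universalCovering a) (fun _ _ => trivial) α

/-- The local actions on the universal covering are compatible, so they glue along the colimit. The
end point map is equivariant, which gives the first clause; induction along based paths gives
transitivity. -/
theorem exists_hom_smul_base_eq (a : Steinberg n R) :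
    ∃ θ : Steinberg n R →* Equiv.Perm ((steinbergAction n R).universalCovering a),
      (∀ x, (θ x ((steinbergAction n R).universalCoveringBase a)).1 = x * a) ∧
      ∀ u, ∃ x, θ x ((steinbergAction n R).universalCoveringBase a) = u := by
  obtain ⟨θ, hθ⟩ := Steinberg.exists_hom (steinbergCoverPerm n R a)
    (fun h x => permHom_map (A := (steinbergAction n R).universalCovering a) _ h x)
  refine ⟨θ, fun x => ?_, fun u => ?_⟩
  · induction x using Steinberg.induction_left with
    | one =>
      rw [map_one, Equiv.Perm.one_apply, one_mul]
      rfl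
    | incl_mul α s x ih =>
      rw [map_mul, Equiv.Perm.mul_apply, hθ, mul_assoc, ← ih]
      rfl
  · induction u using universalCovering_induction (steinbergAction_mem_dom n R) with
    | base => exact ⟨1, by rw [map_one, Equiv.Perm.one_apply]⟩
    | smul α σ u ih =>
      obtain ⟨x, rfl⟩ := ih
      exact ⟨SteinbergOn.incl α.2.1 σ * x, by rw [map_mul, Equiv.Perm.mul_apply, hθ]⟩

/-- The element ba⁻¹ moves the base point to a class of paths from a to b, which gives
connectedness. A loop class at a is the translate of the base point by some x with xa = a, so x = 1
and the class is constant. -/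
theorem steinbergAction_isSimplyConnected : (steinbergAction n R).IsSimplyConnected := by
  refine ⟨⟨⟨(1 : Steinberg n R)⟩, fun a b => ?_⟩, fun a => ⟨fun f g => ?_⟩⟩
  · obtain ⟨θ, hθ, -⟩ := exists_hom_smul_base_eq n R a
    have h := hθ (b * a⁻¹ : Steinberg n R)
    rw [inv_mul_cancel_right] at h
    exact ⟨h ▸ (θ (b * a⁻¹ : Steinberg n R) _).2.mk_surjective.choose⟩
  · obtain ⟨θ, hθ, hsurj⟩ := exists_hom_smul_base_eq n R a
    have key : ∀ f : (steinbergAction n R).PathClass a a,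
        (⟨a, f⟩ : (steinbergAction n R).universalCovering a)
          = (steinbergAction n R).universalCoveringBase a := fun f => by
      obtain ⟨x, hx⟩ := hsurj ⟨a, f⟩
      have hxa := hθ x
      rw [hx] at hxa
      obtain rfl : x = 1 := mul_eq_right.1 hxa.symm
      rw [← hx, map_one, Equiv.Perm.one_apply]
    have h := (key f).trans (key g).symm
    exact eq_of_heq (Sigma.mk.inj h).2

/-! ### The universal covering of the general linear global action -/

/-- The action of the local groups of the Steinberg global action on the universal covering of the
general linear global action. -/
noncomputable abbrev generalLinearCoverPerm (α : ClosedSet n) : SteinbergOn R α.1 →*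
    Equiv.Perm ((generalLinearAction n R).universalCovering
      (1 : Matrix.GeneralLinearGroup (Fin n) R)) :=
  (permHom (A := (generalLinearAction n R).universalCovering
    (1 : Matrix.GeneralLinearGroup (Fin n) R)) (fun _ _ => trivial) α).comp (localEval R α)

theorem exists_steinberg_universalCovering_hom :
    ∃ θ : Steinberg n R →* Equiv.Perm ((generalLinearAction n R).universalCovering
        (1 : Matrix.GeneralLinearGroup (Fin n) R)),
      ∀ (α : ClosedSet n) (x : SteinbergOn R α.1),
        θ (SteinbergOn.incl α.2.1 x) = generalLinearCoverPerm n R α x :=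
  Steinberg.exists_hom (generalLinearCoverPerm n R) fun {α β} h x => by
    rw [MonoidHom.comp_apply, MonoidHom.comp_apply, localEval_incl]
    exact permHom_map (A := (generalLinearAction n R).universalCovering
      (1 : Matrix.GeneralLinearGroup (Fin n) R)) _ h (localEval R α x)

/-- The action of the Steinberg group on the universal covering of the general linear global
action. -/
noncomputable def steinbergCoverHom : Steinberg n R →*
    Equiv.Perm ((generalLinearAction n R).universalCovering
      (1 : Matrix.GeneralLinearGroup (Fin n) R)) :=
  (exists_steinberg_universalCovering_hom n R).choose

theorem steinbergCoverHom_incl (α : ClosedSet n) (x : SteinbergOn R α.1) :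
    steinbergCoverHom n R (SteinbergOn.incl α.2.1 x) = generalLinearCoverPerm n R α x :=
  (exists_steinberg_universalCovering_hom n R).choose_spec α x

/-- The orbit map of the base point of the universal covering of the general linear global
action. -/
noncomputable def steinbergToCover (x : Steinberg n R) :
    (generalLinearAction n R).universalCovering (1 : Matrix.GeneralLinearGroup (Fin n) R) :=
  steinbergCoverHom n R x ((generalLinearAction n R).universalCoveringBase
    (1 : Matrix.GeneralLinearGroup (Fin n) R))

theorem steinbergToCover_one : steinbergToCover n R 1
    = (generalLinearAction n R).universalCoveringBase (1 : Matrix.GeneralLinearGroup (Fin n) R) := by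
  rw [steinbergToCover, map_one, Equiv.Perm.one_apply]

/-- This is the equivariance required of the regular morphism, and the inductive step in all later
computations with the orbit map. -/
theorem steinbergToCover_incl_mul (α : ClosedSet n) (s : SteinbergOn R α.1) (x : Steinberg n R) :
    steinbergToCover n R (SteinbergOn.incl α.2.1 s * x)
      = generalLinearCoverPerm n R α s (steinbergToCover n R x) := by
  rw [steinbergToCover, map_mul, Equiv.Perm.mul_apply, steinbergCoverHom_incl]
  rfl

theorem steinbergToCover_fst (x : Steinberg n R) :
    (steinbergToCover n R x).1 = steinbergEval n R x := by
  induction x using Steinberg.induction_left with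
  | one =>
    rw [steinbergToCover_one, map_one]
    rfl
  | incl_mul α s x ih =>
    rw [steinbergToCover_incl_mul, map_mul, steinbergEval_incl, ← ih]
    rfl

theorem steinbergToCover_surjective : Function.Surjective (steinbergToCover n R) := by
  intro u
  induction u using universalCovering_induction (generalLinearAction_mem_dom n R) with
  | base => exact ⟨1, steinbergToCover_one n R⟩
  | smul α σ u ih =>
    obtain ⟨x, rfl⟩ := ih
    obtain ⟨s, rfl⟩ := (localEval_bijective R α).2 σ
    exact ⟨SteinbergOn.incl α.2.1 s * x, steinbergToCover_incl_mul n R α s x⟩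

/-- The class of paths which corresponds to `x` lifts to a path ending at `x`. -/
theorem exists_lift_steinbergToCover (x : Steinberg n R) :
    ∃ (g : (steinbergAction n R).Path (1 : Steinberg n R) x)
      (f : (generalLinearAction n R).Path (1 : Matrix.GeneralLinearGroup (Fin n) R)
        (steinbergToCover n R x).1),
      PathClass.mk f = (steinbergToCover n R x).2 ∧
        ∀ k, steinbergEval n R (g.toFun k) = f.toFun k := by
  induction x using Steinberg.induction_left with
  | one =>
    rw [steinbergToCover_one]
    exact ⟨Path.const _ (IsCovered.exists_mem_dom _), Path.const _ (IsCovered.exists_mem_dom _), rfl,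
      fun _ => map_one _⟩
  | incl_mul α s x ih =>
    obtain ⟨g, f, hf, hgf⟩ := ih
    rw [steinbergToCover_incl_mul]
    obtain ⟨N, hN⟩ := g.exists_right
    obtain ⟨N', hN'⟩ := f.exists_right
    have h₁ : (steinbergAction n R).IsLocal {x, (SteinbergOn.incl α.2.1 s * x : Steinberg n R)} :=
      isLocal_permHom (steinbergAction_mem_dom n R) (α := α) s x
    have h₂ : (generalLinearAction n R).IsLocal {(steinbergToCover n R x).1,
        (generalLinearCoverPerm n R α s (steinbergToCover n R x)).1} :=
      isLocal_permHom (generalLinearAction_mem_dom n R) (α := α) (localEval R α s) _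
    -- Both concatenations switch at the common position max N N', so that they can be compared
    -- point by point.
    refine ⟨g.concat (Path.link _ _ h₁) (max N N') 0 (fun k hk => hN k (by omega))
        (Path.link_toFun_of_nonpos h₁),
      f.concat (Path.link _ _ h₂) (max N N') 0 (fun k hk => hN' k (by omega))
        (Path.link_toFun_of_nonpos h₂), ?_, fun k => ?_⟩
    · rw [← PathClass.mk_comp_mk, hf]
      rfl
    · rw [Path.concat_toFun, Path.concat_toFun]
      split_ifs
      · exact hgf k
      · rw [Path.link_toFun, Path.link_toFun]
        split_ifs
        · exact (steinbergToCover_fst n R x).symm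
        · rw [map_mul, steinbergEval_incl, ← steinbergToCover_fst]
          rfl

/-- If x and y give the same class, the representing paths are homotopic in the general linear
action. They have lifts from 1 ending at x and at y, and lifts of homotopic paths along a covering
share their end point. -/
theorem steinbergToCover_injective : Function.Injective (steinbergToCover n R) := by
  intro x y h
  obtain ⟨g, f, hf, hgf⟩ := exists_lift_steinbergToCover n R x
  obtain ⟨g', f', hf', hgf'⟩ := exists_lift_steinbergToCover n R y
  -- The end points of f and f' are equal only through h; replacing both points of the covering by
  -- one gives the two paths the same type.
  generalize steinbergToCover n R y = u at *
  subst h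
  exact (isCovering_steinbergEval n R).end_eq_of_homotopic
    (PathClass.mk_eq_mk_iff.1 (hf.trans hf'.symm)) g g' hgf hgf'

/-- The regular morphism from the Steinberg global action to the universal covering of the general
linear global action. -/
noncomputable def steinbergToCoverMorphism : RegularMorphism (steinbergAction n R)
    ((generalLinearAction n R).universalCovering (1 : Matrix.GeneralLinearGroup (Fin n) R)) where
  toFun := steinbergToCover n R
  coordMap α := α
  coordMap_le h := h
  grpMap := localEval R
  grpMap_naturality h σ := localEval_incl h σ
  mapsTo _ _ _ := trivial
  equivariant α σ x _ := steinbergToCover_incl_mul n R α σ x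

theorem steinbergToCoverMorphism_isIso : (steinbergToCoverMorphism n R).IsIso where
  bijective_toFun := ⟨steinbergToCover_injective n R, steinbergToCover_surjective n R⟩
  bijective_coordMap := Function.bijective_id
  le_of_coordMap_le _ _ h := h
  bijective_grpMap := localEval_bijective R
  mem_dom_of_toFun_mem _ _ _ := trivial

/-- The orbit map is onto and lies over evaluation, so the end points of paths from 1 are precisely
the values of `steinbergEval`. -/
theorem mem_elementaryGroup_iff_nonempty_path (g : Matrix.GeneralLinearGroup (Fin n) R) :
    g ∈ elementaryGroup n R ↔
      Nonempty ((generalLinearAction n R).Path (1 : Matrix.GeneralLinearGroup (Fin n) R) g) := by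
  rw [← steinbergEval_range]
  constructor
  · rintro ⟨x, rfl⟩
    rw [← steinbergToCover_fst]
    exact ⟨(exists_lift_steinbergToCover n R x).choose_spec.choose⟩
  · rintro ⟨f⟩
    obtain ⟨x, hx⟩ := steinbergToCover_surjective n R ⟨g, PathClass.mk f⟩
    exact ⟨x, by rw [← steinbergToCover_fst, hx]⟩

/-! ### The universal property -/

/-- The local groups act on B by lifting steps, and these actions glue to an action F of the
Steinberg group; the morphism is the orbit map of b. Its uniqueness is unique lifting of single
steps, since such steps lead from 1 to every element. -/
theorem existsUnique_lift_steinbergEval (B : GlobalAction.{u₁, u₂, u₃})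
    (q : B → generalLinearAction n R) (b : B) (hq : IsCovering B (generalLinearAction n R) q)
    (hb : q b = (1 : Matrix.GeneralLinearGroup (Fin n) R)) :
    ∃! f : steinbergAction n R → B, IsMorphism (steinbergAction n R) B f ∧
      f (1 : Steinberg n R) = b ∧ ∀ x : Steinberg n R, q (f x) = steinbergEval n R x := by
  obtain ⟨ρ, hρ⟩ := hq.exists_permHom (generalLinearAction_mem_dom n R)
  obtain ⟨F, hF⟩ := Steinberg.exists_hom (fun α => (ρ α).comp (localEval R α))
    (fun {α β} h x => by
      -- Both permutations move y to the end of a lift of the same step, so they agree.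
      refine Equiv.ext fun y => hq.lift_unique (hρ _ _ y).1 (hρ _ _ y).1 ?_
      change q (ρ β _ y) = q (ρ α _ y)
      rw [(hρ _ _ _).2, (hρ _ _ _).2, localEval_incl]
      exact congrArg (fun e => e (q y))
        (permHom_map (generalLinearAction_mem_dom n R) h (localEval R α x)))
  have hFq : ∀ (α : ClosedSet n) (s : SteinbergOn R α.1) y,
      B.IsLocal {y, F (SteinbergOn.incl α.2.1 s) y} ∧
        q (F (SteinbergOn.incl α.2.1 s) y)
          = (steinbergEval n R (SteinbergOn.incl α.2.1 s) * q y :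
            Matrix.GeneralLinearGroup (Fin n) R) := fun α s y => by
    rw [hF, steinbergEval_incl]
    exact hρ α (localEval R α s) y
  have hq1 : ∀ x, q (F x b) = steinbergEval n R x := fun x => by
    induction x using Steinberg.induction_left with
    | one => rw [map_one, map_one, Equiv.Perm.one_apply, hb]
    | incl_mul α s x ih => rw [map_mul, Equiv.Perm.mul_apply, (hFq α s _).2, ih, map_mul]
  refine ⟨fun x => F x b, ⟨?_, congrArg (fun e => e b) (map_one F), hq1⟩, ?_⟩
  · intro p x hx
    have hx' := (isCovering_steinbergEval n R).1 p x hx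
    obtain ⟨α, _, hx⟩ := hx
    -- The image frame is lifted from F (x 0) b. Each F (x i) b is adjacent to that point and lies
    -- over the same point as y i, so the orbit map sends the frame to this lift.
    obtain ⟨y, hy, hy0, hyx⟩ := hq.exists_lift_frame ((isLocalFrame_iff _ _).1 hx') (hq1 (x 0))
    rw [isLocalFrame_iff]
    have : (fun i => F (x i) b) = y := funext fun i => by
      obtain ⟨s, hs⟩ := hx i
      change SteinbergOn.incl α.2.1 s * x 0 = x i at hs
      have h1 := (hFq α s (F (x 0) b)).1
      rw [← Equiv.Perm.mul_apply, ← map_mul, hs] at h1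
      refine hq.lift_unique h1 (hy.mono ?_) ((hq1 _).trans (hyx i).symm)
      rintro _ (rfl | rfl)
      exacts [⟨0, hy0⟩, ⟨i, rfl⟩]
    rw [this]
    exact hy
  · rintro f ⟨hf, hf1, hfq⟩
    funext x
    induction x using Steinberg.induction_left with
    | one => rw [hf1, map_one, Equiv.Perm.one_apply]
    | incl_mul α s x ih =>
      have hfr : (steinbergAction n R).IsLocalFrame (p := 1)
          ![x, (SteinbergOn.incl α.2.1 s * x : Steinberg n R)] := by
        rw [isLocalFrame_iff]
        refine (isLocal_permHom (steinbergAction_mem_dom n R) (α := α) s x).mono ?_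
        rintro _ ⟨i, rfl⟩
        fin_cases i
        exacts [Or.inl rfl, Or.inr rfl]
      have h1 := (isLocalFrame_iff _ _).1 (hf 1 _ hfr)
      rw [map_mul, Equiv.Perm.mul_apply, ← ih]
      refine hq.lift_unique (y := f x) (h1.mono ?_) (hFq α s _).1 ?_
      · rintro _ (rfl | rfl)
        exacts [⟨0, rfl⟩, ⟨1, rfl⟩]
      · rw [(hFq α s _).2, hfq, hfq, map_mul]

/-! ### The fundamental group of the general linear global action -/

/-- The class of loops which corresponds to an element of the kernel of evaluation. -/
noncomputable def kTwoLoop (x : KTwo n R) : (generalLinearAction n R).FundamentalGroup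
    (1 : Matrix.GeneralLinearGroup (Fin n) R) :=
  cast (congrArg ((generalLinearAction n R).PathClass (1 : Matrix.GeneralLinearGroup (Fin n) R))
    ((steinbergToCover_fst n R x.1).trans (congrArg Subtype.val x.2))) (steinbergToCover n R x.1).2

/-- The cast in `kTwoLoop` vanishes once the loop is viewed as a point of the universal covering, so
loops are compared there. -/
theorem sigma_kTwoLoop (x : KTwo n R) :
    (⟨(1 : Matrix.GeneralLinearGroup (Fin n) R), kTwoLoop n R x⟩ :
      (generalLinearAction n R).universalCovering (1 : Matrix.GeneralLinearGroup (Fin n) R))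
      = steinbergToCover n R x.1 := by
  have h : (steinbergToCover n R x.1).1 = (1 : Matrix.GeneralLinearGroup (Fin n) R) :=
    (steinbergToCover_fst n R x.1).trans (congrArg Subtype.val x.2)
  refine Sigma.ext h.symm ?_
  exact cast_heq _ _

/-- The action of the Steinberg group on based paths commutes with precomposition by loops. -/
theorem steinbergToCover_mul (x : Steinberg n R) (y : KTwo n R) :
    steinbergToCover n R (x * y.1)
      = ⟨(steinbergToCover n R x).1, (kTwoLoop n R y).comp (steinbergToCover n R x).2⟩ := by
  induction x using Steinberg.induction_left with
  | one =>
    rw [one_mul, steinbergToCover_one, ← sigma_kTwoLoop]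
    exact congrArg (Sigma.mk _) (PathClass.comp_const _ _).symm
  | incl_mul α s x ih =>
    rw [mul_assoc, steinbergToCover_incl_mul, ih, steinbergToCover_incl_mul]
    exact congrArg (Sigma.mk _) (PathClass.comp_assoc _ _ _)

/-- In xy the factor y acts first on the base point, so its loop is traversed first and the product
is reversed. -/
theorem kTwoLoop_mul (x y : KTwo n R) :
    kTwoLoop n R (x * y) = kTwoLoop n R y * kTwoLoop n R x := by
  have h := steinbergToCover_mul n R x.1 y
  rw [← sigma_kTwoLoop n R x] at h
  have h' := (sigma_kTwoLoop n R (x * y)).trans h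
  exact eq_of_heq (Sigma.mk.inj h').2

/-- This is the bijection `steinbergToCover` restricted to the fibres over 1: the kernel of
evaluation on one side, classes of loops on the other. -/
theorem kTwoLoop_bijective : Function.Bijective (kTwoLoop n R) := by
  constructor
  · intro x y h
    have h' := sigma_kTwoLoop n R x
    rw [h, sigma_kTwoLoop] at h'
    exact Subtype.ext (steinbergToCover_injective n R h'.symm)
  · intro f
    obtain ⟨x, hx⟩ := steinbergToCover_surjective n R ⟨(1 : Matrix.GeneralLinearGroup (Fin n) R), f⟩
    have hx1 : x ∈ KTwo n R := Subtype.ext (by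
      change steinbergEval n R x = 1
      rw [← steinbergToCover_fst, hx])
    have h := (sigma_kTwoLoop n R ⟨x, hx1⟩).trans hx
    exact ⟨⟨x, hx1⟩, eq_of_heq (Sigma.mk.inj h).2⟩

/-- The kernel of evaluation is the fundamental group of the general linear global action. The
inversion accounts for the order of concatenation. -/
noncomputable def kTwoEquivFundamentalGroup : KTwo n R ≃* (generalLinearAction n R).FundamentalGroup
    (1 : Matrix.GeneralLinearGroup (Fin n) R) :=
  MulEquiv.ofBijective
    (MonoidHom.mk' (fun x => kTwoLoop n R x⁻¹) fun x y => by rw [mul_inv_rev, kTwoLoop_mul])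
    ((kTwoLoop_bijective n R).comp (Equiv.inv (KTwo n R)).bijective)

end SteinbergCovering

/-! ### The theorem and its corollary. -/

theorem mainTheorem1 (n : ℕ) (R : Type u) [Ring R] :
    -- the Steinberg global action is simply connected
    (steinbergAction n R).IsSimplyConnected ∧
    -- evaluation is a covering map
    GlobalAction.IsCovering (steinbergAction n R) (generalLinearAction n R) (steinbergEval n R) ∧
    -- its image is the elementary group, the connected component of the identity, and it is a
    -- surjective covering of the latter
    (steinbergEval n R).range = elementaryGroup n R ∧
    (∀ g : Matrix.GeneralLinearGroup (Fin n) R, g ∈ elementaryGroup n R ↔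
      Nonempty ((generalLinearAction n R).Path (1 : Matrix.GeneralLinearGroup (Fin n) R) g)) ∧
    GlobalAction.IsCovering (steinbergAction n R) (elementaryAction n R)
      (steinbergToElementary n R) ∧
    Function.Surjective (steinbergToElementary n R) ∧
    -- it is regularly isomorphic, over the general linear global action, to the universal
    -- covering constructed from homotopy classes of based paths
    (∃ η : GlobalAction.RegularMorphism (steinbergAction n R)
        ((generalLinearAction n R).universalCovering (1 : Matrix.GeneralLinearGroup (Fin n) R)),
      η.IsIso ∧ (∀ α : ClosedSet n, η.coordMap α = α) ∧
      η.toFun (1 : Steinberg n R)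
        = (generalLinearAction n R).universalCoveringBase
            (1 : Matrix.GeneralLinearGroup (Fin n) R) ∧
      ∀ x : Steinberg n R, (generalLinearAction n R).universalCoveringMap
        (1 : Matrix.GeneralLinearGroup (Fin n) R) (η.toFun x) = steinbergEval n R x) ∧
    -- it is universal among the coverings of the general linear global action with a base point
    -- over the identity
    (∀ (B : GlobalAction.{u₁, u₂, u₃}) (q : B → generalLinearAction n R) (b : B),
      GlobalAction.IsCovering B (generalLinearAction n R) q →
      q b = (1 : Matrix.GeneralLinearGroup (Fin n) R) →
      ∃! f : steinbergAction n R → B, GlobalAction.IsMorphism (steinbergAction n R) B f ∧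
        f (1 : Steinberg n R) = b ∧ ∀ x : Steinberg n R, q (f x) = steinbergEval n R x) ∧
    -- the fundamental group of the general linear global action
    Nonempty (KTwo n R ≃* (generalLinearAction n R).FundamentalGroup
      (1 : Matrix.GeneralLinearGroup (Fin n) R)) :=
  ⟨steinbergAction_isSimplyConnected n R, isCovering_steinbergEval n R, steinbergEval_range n R,
    mem_elementaryGroup_iff_nonempty_path n R, isCovering_steinbergToElementary n R,
    steinbergToElementary_surjective n R,
    ⟨steinbergToCoverMorphism n R, steinbergToCoverMorphism_isIso n R, fun _ => rfl,
      steinbergToCover_one n R, steinbergToCover_fst n R⟩,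
    existsUnique_lift_steinbergEval n R, ⟨kTwoEquivFundamentalGroup n R⟩⟩
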